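/- Let $k$ be a perfect field of characteristic $p>0$, let $K/k$ be a field extension, and let $K^{\mathrm{perf}}$ be the perfect closure of $K$. Let $\mathcal D_\infty(K/k)$ be the category of triples $(V,W,\psi)$, where $V$ is a finite dimensional $K$-vector space, $W$ is a finite dimensional $k$-vector space and $\psi\colon K^{\mathrm{perf}}\otimes_K V\to K^{\mathrm{perf}}\otimes_k W$ is a $K^{\mathrm{perf}}$-linear isomorphism; an arrow $(V,W,\psi)\to(V',W',\psi')$ is a pair $(a,b)$ of a $K$-linear map $a\colon V\to V'$ and a $k$-linear map $b\colon W\to W'$ with $\psi'\circ(\mathrm{id}\otimes a)=(\mathrm{id}\otimes b)\circ\psi$. The tensor product is $(V,W,\psi)\otimes(V',W',\psi')=(V\otimes_KV',W\otimes_kW',\psi\otimes\psi')$, with unit object $(K,k,1)$, and $\mathrm{Pic}(\mathcal D_\infty(K/k))$ is the group of isomorphism classes of $\otimes$-invertible objects. Let $\omega\colon(V,W,\psi)\mapsto W$ be the forgetful fibre functor to finite dimensional $k$-vector spaces, and let $\pi^{\mathrm L}(K/k)=\underline{\mathrm{Aut}}^{\otimes}(\omega)$ be the associated Tannakian group, that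 is, the group functor sending a commutative $k$-algebra $R$ to the group of $R$-linear tensor automorphisms of $X\mapsto R\otimes_k\omega(X)$. Then $\pi^{\mathrm L}(K/k)$ is an affine group scheme over $k$, and there are canonical isomorphisms of groups \[ \mathrm{Pic}(\mathcal D_\infty(K/k))\;\simeq\;\mathrm{Hom}_k(\pi^{\mathrm L}(K/k),\mathbb G_m)\;\simeq\;(K^{\mathrm{perf}})^*/K^* . \] The first one sends the class of an invertible object $L$ to the character through which $\pi^{\mathrm L}(K/k)$ acts on the line $\omega(L)$. Under the composite, the class of $\varphi\in(K^{\mathrm{perf}})^*$ corresponds to the class of the rank-one object $(K,k,\varphi)$, where $\varphi$ acts by multiplication on $K^{\mathrm{perf}}\otimes_KK=K^{\mathrm{perf}}=K^{\mathrm{perf}}\otimes_kk$. -/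

import Mathlib

open CategoryTheory MonoidalCategory TensorProduct

universe u

noncomputable section

/-- Objects of the category `D_∞(K/k)`, where `P` stands for the perfect closure of `K`: triples
`(V, W, ψ)` of a finite dimensional `K`-vector space `V`, a finite dimensional `k`-vector space `W`
and a `P`-linear isomorphism `ψ : P ⊗_K V ≃ P ⊗_k W`. -/
structure DInf (k K P : Type u) [Field k] [Field K] [Field P] [Algebra K P] [Algebra k P] :
    Type (u + 1) where
  V : Type u
  W : Type u
  [addCommGroupV : AddCommGroup V]
  [moduleV : Module K V]
  [finiteV : Module.Finite K V]
  [addCommGroupW : AddCommGroup W]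
  [moduleW : Module k W]
  [finiteW : Module.Finite k W]
  ψ : P ⊗[K] V ≃ₗ[P] P ⊗[k] W

namespace DInf

attribute [instance] addCommGroupV moduleV finiteV addCommGroupW moduleW finiteW

variable {k K P : Type u} [Field k] [Field K] [Field P] [Algebra K P] [Algebra k P]

/-- Arrows of `D_∞(K/k)`: pairs of a `K`-linear map `a` and a `k`-linear map `b` that are compatible
with the isomorphisms `ψ`. -/
@[ext]
structure Hom (X Y : DInf k K P) : Type u where
  a : X.V →ₗ[K] Y.V
  b : X.W →ₗ[k] Y.W
  comm : Y.ψ.toLinearMap ∘ₗ a.baseChange P = b.baseChange P ∘ₗ X.ψ.toLinearMap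

theorem Hom.comm_apply {X Y : DInf k K P} (f : Hom X Y) (x : P ⊗[K] X.V) :
    Y.ψ (f.a.baseChange P x) = f.b.baseChange P (X.ψ x) :=
  LinearMap.congr_fun f.comm x

instance : Category (DInf k K P) where
  Hom := Hom
  id X := ⟨LinearMap.id, LinearMap.id, by ext; simp⟩
  comp f g := ⟨g.a ∘ₗ f.a, g.b ∘ₗ f.b, by
    rw [LinearMap.baseChange_comp, LinearMap.baseChange_comp, ← LinearMap.comp_assoc, g.comm,
      LinearMap.comp_assoc, f.comm, LinearMap.comp_assoc]⟩

@[ext]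
theorem hom_ext {X Y : DInf k K P} {f g : X ⟶ Y} (ha : f.a = g.a) (hb : f.b = g.b) : f = g :=
  Hom.ext ha hb

@[simp] theorem id_a (X : DInf k K P) : Hom.a (𝟙 X) = LinearMap.id := rfl
@[simp] theorem id_b (X : DInf k K P) : Hom.b (𝟙 X) = LinearMap.id := rfl
@[simp] theorem comp_a {X Y Z : DInf k K P} (f : X ⟶ Y) (g : Y ⟶ Z) :
    Hom.a (f ≫ g) = g.a ∘ₗ f.a := rfl
@[simp] theorem comp_b {X Y Z : DInf k K P} (f : X ⟶ Y) (g : Y ⟶ Z) :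
    Hom.b (f ≫ g) = g.b ∘ₗ f.b := rfl

/-- A pair of linear isomorphisms compatible with the `ψ` is an isomorphism of `D_∞(K/k)`. -/
def mkIso {X Y : DInf k K P} (a : X.V ≃ₗ[K] Y.V) (b : X.W ≃ₗ[k] Y.W)
    (h : Y.ψ.toLinearMap ∘ₗ a.toLinearMap.baseChange P =
      b.toLinearMap.baseChange P ∘ₗ X.ψ.toLinearMap) : X ≅ Y where
  hom := ⟨a.toLinearMap, b.toLinearMap, h⟩
  inv := ⟨a.symm.toLinearMap, b.symm.toLinearMap, by
    have ha : a.toLinearMap.baseChange P ∘ₗ a.symm.toLinearMap.baseChange P = LinearMap.id := by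
      rw [← LinearMap.baseChange_comp]; ext; simp
    have hb : b.symm.toLinearMap.baseChange P ∘ₗ b.toLinearMap.baseChange P = LinearMap.id := by
      rw [← LinearMap.baseChange_comp]; ext; simp
    calc X.ψ.toLinearMap ∘ₗ a.symm.toLinearMap.baseChange P
        = (b.symm.toLinearMap.baseChange P ∘ₗ b.toLinearMap.baseChange P) ∘ₗ
            X.ψ.toLinearMap ∘ₗ a.symm.toLinearMap.baseChange P := by rw [hb, LinearMap.id_comp]
      _ = b.symm.toLinearMap.baseChange P ∘ₗ (b.toLinearMap.baseChange P ∘ₗ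
            X.ψ.toLinearMap) ∘ₗ a.symm.toLinearMap.baseChange P := by
          simp only [LinearMap.comp_assoc]
      _ = b.symm.toLinearMap.baseChange P ∘ₗ Y.ψ.toLinearMap := by
          rw [← h, LinearMap.comp_assoc, ha, LinearMap.comp_id]⟩
  hom_inv_id := by ext <;> simp
  inv_hom_id := by ext <;> simp

/-- The isomorphism `P ⊗_K (V ⊗_K V') ≃ P ⊗_k (W ⊗_k W')` induced by `ψ` and `ψ'`. -/
def tensorψ (X Y : DInf k K P) : P ⊗[K] (X.V ⊗[K] Y.V) ≃ₗ[P] P ⊗[k] (X.W ⊗[k] Y.W) :=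
  AlgebraTensorModule.distribBaseChange K P X.V Y.V ≪≫ₗ
    TensorProduct.congr X.ψ Y.ψ ≪≫ₗ
    (AlgebraTensorModule.distribBaseChange k P X.W Y.W).symm

/-- `(V, W, ψ) ⊗ (V', W', ψ') = (V ⊗_K V', W ⊗_k W', ψ ⊗ ψ')`. -/
abbrev tensor (X Y : DInf k K P) : DInf k K P where
  V := X.V ⊗[K] Y.V
  W := X.W ⊗[k] Y.W
  ψ := tensorψ X Y

/-- The rank one object `(K, k, φ)`, where `φ ∈ P^*` acts by multiplication on
`P ⊗_K K = P = P ⊗_k k`. -/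
abbrev line (k K : Type u) {P : Type u} [Field k] [Field K] [Field P] [Algebra K P] [Algebra k P]
    (φ : Pˣ) : DInf k K P where
  V := K
  W := k
  ψ := AlgebraTensorModule.rid K P P ≪≫ₗ LinearEquiv.smulOfUnit φ ≪≫ₗ
    (AlgebraTensorModule.rid k P P).symm

theorem line_ψ_tmul (φ : Pˣ) (x : P) (y : K) :
    (line k K φ).ψ (x ⊗ₜ[K] (y : K)) = ((φ : P) * (y • x)) ⊗ₜ[k] (1 : k) :=
  rfl

theorem tensorψ_tmul (X Y : DInf k K P) (r : P) (v : X.V) (v' : Y.V) :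
    tensorψ X Y (r ⊗ₜ[K] (v ⊗ₜ[K] v')) =
      (AlgebraTensorModule.distribBaseChange k P X.W Y.W).symm
        (X.ψ (r ⊗ₜ[K] v) ⊗ₜ[P] Y.ψ (1 ⊗ₜ[K] v')) :=
  rfl

theorem map_baseChange_distrib {R M N M' N' : Type u} [Field R] [Algebra R P]
    [AddCommGroup M] [Module R M] [AddCommGroup N] [Module R N]
    [AddCommGroup M'] [Module R M'] [AddCommGroup N'] [Module R N']
    (f : M →ₗ[R] M') (g : N →ₗ[R] N') (s : P ⊗[R] M) (t : P ⊗[R] N) :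
    (TensorProduct.map f g).baseChange P
        ((AlgebraTensorModule.distribBaseChange R P M N).symm (s ⊗ₜ[P] t)) =
      (AlgebraTensorModule.distribBaseChange R P M' N').symm
        (f.baseChange P s ⊗ₜ[P] g.baseChange P t) := by
  induction s with
  | zero => simp
  | add s₁ s₂ h₁ h₂ => simp only [map_add, TensorProduct.add_tmul, h₁, h₂]
  | tmul p m =>
    induction t with
    | zero => simp
    | add t₁ t₂ h₁ h₂ => simp only [map_add, TensorProduct.tmul_add, h₁, h₂]
    | tmul q n => simp

theorem assoc_baseChange_distrib {R L M N : Type u} [Field R] [Algebra R P]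
    [AddCommGroup L] [Module R L] [AddCommGroup M] [Module R M] [AddCommGroup N] [Module R N]
    (r : P ⊗[R] L) (s : P ⊗[R] M) (t : P ⊗[R] N) :
    (TensorProduct.assoc R L M N).toLinearMap.baseChange P
        ((AlgebraTensorModule.distribBaseChange R P (L ⊗[R] M) N).symm
          ((AlgebraTensorModule.distribBaseChange R P L M).symm (r ⊗ₜ[P] s) ⊗ₜ[P] t)) =
      (AlgebraTensorModule.distribBaseChange R P L (M ⊗[R] N)).symm
        (r ⊗ₜ[P] (AlgebraTensorModule.distribBaseChange R P M N).symm (s ⊗ₜ[P] t)) := by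
  induction r with
  | zero => simp
  | add s₁ s₂ h₁ h₂ => simp only [map_add, TensorProduct.add_tmul, h₁, h₂]
  | tmul p m =>
    induction s with
    | zero => simp
    | add t₁ t₂ h₁ h₂ => simp only [map_add, TensorProduct.tmul_add, TensorProduct.add_tmul, h₁, h₂]
    | tmul q n =>
      induction t with
      | zero => simp
      | add t₁ t₂ h₁ h₂ => simp only [map_add, TensorProduct.tmul_add, h₁, h₂]
      | tmul q' n' => simp [mul_assoc]

theorem lid_baseChange_distrib {R M : Type u} [Field R] [Algebra R P]
    [AddCommGroup M] [Module R M] (p : P) (t : P ⊗[R] M) :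
    (TensorProduct.lid R M).toLinearMap.baseChange P
        ((AlgebraTensorModule.distribBaseChange R P R M).symm ((p ⊗ₜ[R] 1) ⊗ₜ[P] t)) = p • t := by
  induction t with
  | zero => simp
  | add t₁ t₂ h₁ h₂ => simp only [map_add, TensorProduct.tmul_add, h₁, h₂, smul_add]
  | tmul q n => simp [TensorProduct.smul_tmul']

theorem rid_baseChange_distrib {R M : Type u} [Field R] [Algebra R P]
    [AddCommGroup M] [Module R M] (p : P) (t : P ⊗[R] M) :
    (TensorProduct.rid R M).toLinearMap.baseChange P
        ((AlgebraTensorModule.distribBaseChange R P M R).symm (t ⊗ₜ[P] (p ⊗ₜ[R] 1))) = p • t := by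
  induction t with
  | zero => simp
  | add t₁ t₂ h₁ h₂ => simp only [map_add, TensorProduct.add_tmul, h₁, h₂, smul_add]
  | tmul q n => simp [TensorProduct.smul_tmul', mul_comm]

theorem baseChange_tensor_ext {R M N Q : Type u} [Field R] [Algebra R P]
    [AddCommGroup M] [Module R M] [AddCommGroup N] [Module R N] [AddCommGroup Q] [Module P Q]
    {f g : P ⊗[R] (M ⊗[R] N) →ₗ[P] Q}
    (h : ∀ m n, f (1 ⊗ₜ[R] (m ⊗ₜ[R] n)) = g (1 ⊗ₜ[R] (m ⊗ₜ[R] n))) : f = g := by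
  let _ := Module.compHom Q (algebraMap R P)
  have : IsScalarTower R P Q := ⟨fun r p q => by
    rw [Algebra.smul_def, mul_smul]; rfl⟩
  ext m n
  exact h m n

/-- The tensor product `(a ⊗ a', b ⊗ b')` of two arrows. -/
def homTensor {X X' Y Y' : DInf k K P} (f : X ⟶ X') (g : Y ⟶ Y') : tensor X Y ⟶ tensor X' Y' where
  a := TensorProduct.map f.a g.a
  b := TensorProduct.map f.b g.b
  comm := by
    refine baseChange_tensor_ext fun v v' => ?_
    change tensorψ X' Y' (1 ⊗ₜ[K] (f.a v ⊗ₜ[K] g.a v')) =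
      (TensorProduct.map f.b g.b).baseChange P (tensorψ X Y (1 ⊗ₜ[K] (v ⊗ₜ[K] v')))
    rw [tensorψ_tmul, tensorψ_tmul, map_baseChange_distrib, ← f.comm_apply, ← g.comm_apply,
      LinearMap.baseChange_tmul, LinearMap.baseChange_tmul]

def associatorIso (X Y Z : DInf k K P) : tensor (tensor X Y) Z ≅ tensor X (tensor Y Z) :=
  mkIso (TensorProduct.assoc K X.V Y.V Z.V) (TensorProduct.assoc k X.W Y.W Z.W) (by
    refine baseChange_tensor_ext fun xy z => ?_
    induction xy using TensorProduct.induction_on with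
    | zero => simp only [TensorProduct.zero_tmul, TensorProduct.tmul_zero, map_zero]
    | add s t hs ht => simp only [TensorProduct.add_tmul, TensorProduct.tmul_add, map_add, hs, ht]
    | tmul x y => ?_
    change tensorψ X (tensor Y Z) (1 ⊗ₜ[K] (x ⊗ₜ[K] (y ⊗ₜ[K] z))) =
      (TensorProduct.assoc k X.W Y.W Z.W).toLinearMap.baseChange P
        (tensorψ (tensor X Y) Z (1 ⊗ₜ[K] ((x ⊗ₜ[K] y) ⊗ₜ[K] z)))
    rw [tensorψ_tmul, tensorψ_tmul]
    exact (assoc_baseChange_distrib (X.ψ (1 ⊗ₜ x)) (Y.ψ (1 ⊗ₜ y)) (Z.ψ (1 ⊗ₜ z))).symm)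

theorem ψ_smul (X : DInf k K P) (c : K) (x : X.V) :
    X.ψ (1 ⊗ₜ[K] (c • x)) = (c • (1 : P)) • X.ψ (1 ⊗ₜ[K] x) := by
  rw [← map_smul, TensorProduct.smul_tmul', smul_eq_mul, mul_one, TensorProduct.smul_tmul]

def leftUnitorIso (X : DInf k K P) : tensor (line k K 1) X ≅ X :=
  mkIso (TensorProduct.lid K X.V) (TensorProduct.lid k X.W) (by
    refine baseChange_tensor_ext fun (c : K) x => ?_
    have h : (line k K (1 : Pˣ)).ψ (1 ⊗ₜ[K] c) = (c • (1 : P)) ⊗ₜ[k] (1 : k) := by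
      rw [line_ψ_tmul, Units.val_one, one_mul]
    change X.ψ (1 ⊗ₜ[K] (c • x)) =
      (TensorProduct.lid k X.W).toLinearMap.baseChange P
        (tensorψ (line k K 1) X (1 ⊗ₜ[K] (c ⊗ₜ[K] x)))
    rw [tensorψ_tmul, h, ψ_smul]
    exact (lid_baseChange_distrib _ (X.ψ (1 ⊗ₜ x))).symm)

def rightUnitorIso (X : DInf k K P) : tensor X (line k K 1) ≅ X :=
  mkIso (TensorProduct.rid K X.V) (TensorProduct.rid k X.W) (by
    refine baseChange_tensor_ext fun x (c : K) => ?_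
    have h : (line k K (1 : Pˣ)).ψ (1 ⊗ₜ[K] c) = (c • (1 : P)) ⊗ₜ[k] (1 : k) := by
      rw [line_ψ_tmul, Units.val_one, one_mul]
    change X.ψ (1 ⊗ₜ[K] (c • x)) =
      (TensorProduct.rid k X.W).toLinearMap.baseChange P
        (tensorψ X (line k K 1) (1 ⊗ₜ[K] (x ⊗ₜ[K] c)))
    rw [tensorψ_tmul, h, ψ_smul]
    exact (rid_baseChange_distrib _ (X.ψ (1 ⊗ₜ x))).symm)

instance : MonoidalCategoryStruct (DInf k K P) where
  tensorObj := tensor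
  tensorUnit := line k K 1
  tensorHom f g := homTensor f g
  whiskerLeft X _ _ f := homTensor (𝟙 X) f
  whiskerRight f Y := homTensor f (𝟙 Y)
  associator := associatorIso
  leftUnitor := leftUnitorIso
  rightUnitor := rightUnitorIso

instance : MonoidalCategory (DInf k K P) where
  tensorHom_def f g := by
    apply hom_ext <;> apply TensorProduct.ext' <;> intros <;> rfl
  id_tensorHom_id X Y := by
    apply hom_ext <;> apply TensorProduct.ext' <;> intros <;> rfl
  tensorHom_comp_tensorHom f₁ f₂ g₁ g₂ := by
    apply hom_ext <;> apply TensorProduct.ext' <;> intros <;> rfl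
  whiskerLeft_id X Y := by
    apply hom_ext <;> apply TensorProduct.ext' <;> intros <;> rfl
  id_whiskerRight X Y := by
    apply hom_ext <;> apply TensorProduct.ext' <;> intros <;> rfl
  associator_naturality f₁ f₂ f₃ := by
    apply hom_ext <;> apply TensorProduct.ext_threefold <;> intros <;> rfl
  leftUnitor_naturality f := by
    apply hom_ext
    · exact TensorProduct.ext' fun (c : K) x => ((Hom.a f).map_smul c x).symm
    · exact TensorProduct.ext' fun (c : k) x => ((Hom.b f).map_smul c x).symm
  rightUnitor_naturality f := by
    apply hom_ext
    · exact TensorProduct.ext' fun x (c : K) => ((Hom.a f).map_smul c x).symm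
    · exact TensorProduct.ext' fun x (c : k) => ((Hom.b f).map_smul c x).symm
  pentagon W X Y Z := by
    apply hom_ext <;> apply TensorProduct.ext_fourfold <;> intros <;> rfl
  triangle X Y := by
    apply hom_ext
    · exact TensorProduct.ext_threefold fun x (c : K) y => (TensorProduct.smul_tmul c x y).symm
    · exact TensorProduct.ext_threefold fun x (c : k) y => (TensorProduct.smul_tmul c x y).symm

/-- The Picard group of `D_∞(K/k)`: isomorphism classes of objects that are invertible for the
tensor product. -/
abbrev Pic (k K P : Type u) [Field k] [Field K] [Field P] [Algebra K P] [Algebra k P] :=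
  (Skeleton (DInf k K P))ˣ

end DInf

/-- The base change `S ⊗_R g` along `f : R → S` of an `R`-linear endomorphism `g` of `R ⊗_k W`,
as an endomorphism of `S ⊗_k W`. -/
def endBaseChange {k R S W : Type u} [Field k] [CommRing R] [Algebra k R] [CommRing S] [Algebra k S]
    [AddCommGroup W] [Module k W] (f : R →ₐ[k] S) (g : R ⊗[k] W →ₗ[R] R ⊗[k] W) :
    S ⊗[k] W →ₗ[S] S ⊗[k] W :=
  LinearMap.liftBaseChange S
    (LinearMap.rTensor W f.toLinearMap ∘ₗ g.restrictScalars k ∘ₗ TensorProduct.mk k R W 1)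

section endBaseChange

variable {k R S W W' : Type u} [Field k] [CommRing R] [Algebra k R] [CommRing S] [Algebra k S]
  [AddCommGroup W] [Module k W] [AddCommGroup W'] [Module k W'] (f : R →ₐ[k] S)

theorem rTensor_algHom_smul (r : R) (x : R ⊗[k] W) :
    LinearMap.rTensor W f.toLinearMap (r • x) = f r • LinearMap.rTensor W f.toLinearMap x := by
  induction x with
  | zero => simp
  | add x y hx hy => simp only [smul_add, map_add, hx, hy]
  | tmul a w => simp [TensorProduct.smul_tmul']

theorem endBaseChange_rTensor (g : R ⊗[k] W →ₗ[R] R ⊗[k] W) (x : R ⊗[k] W) :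
    endBaseChange f g (LinearMap.rTensor W f.toLinearMap x) =
      LinearMap.rTensor W f.toLinearMap (g x) := by
  induction x with
  | zero => simp
  | add x y hx hy => simp only [map_add, hx, hy]
  | tmul a w =>
    have h : a ⊗ₜ[k] w = a • ((1 : R) ⊗ₜ[k] w) := by simp [TensorProduct.smul_tmul']
    rw [h, rTensor_algHom_smul, map_smul, map_smul, rTensor_algHom_smul]
    simp [endBaseChange]

/-- An `S`-linear map out of `S ⊗_k W` is determined on the image of `R ⊗_k W`. -/
theorem ext_rTensor {Q : Type u} [AddCommGroup Q] [Module S Q] {a b : S ⊗[k] W →ₗ[S] Q}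
    (h : ∀ x : R ⊗[k] W, a (LinearMap.rTensor W f.toLinearMap x) =
      b (LinearMap.rTensor W f.toLinearMap x)) : a = b := by
  refine LinearMap.ext fun y => ?_
  induction y with
  | zero => simp
  | add x y hx hy => simp only [map_add, hx, hy]
  | tmul s w =>
    have hw : s ⊗ₜ[k] w = s • LinearMap.rTensor W f.toLinearMap ((1 : R) ⊗ₜ[k] w) := by
      simp [TensorProduct.smul_tmul']
    rw [hw, map_smul, map_smul, h]

theorem endBaseChange_one : endBaseChange f (LinearMap.id : R ⊗[k] W →ₗ[R] _) = LinearMap.id :=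
  ext_rTensor f fun x => by rw [endBaseChange_rTensor]; rfl

theorem endBaseChange_comp (g h : R ⊗[k] W →ₗ[R] R ⊗[k] W) :
    endBaseChange f (g ∘ₗ h) = endBaseChange f g ∘ₗ endBaseChange f h :=
  ext_rTensor f fun x => by
    rw [endBaseChange_rTensor, LinearMap.comp_apply, LinearMap.comp_apply, endBaseChange_rTensor,
      endBaseChange_rTensor]

/-- Base change along `f : R → S` as a map `GL_R(R ⊗_k W) → GL_S(S ⊗_k W)`. -/
def autBaseChange (g : R ⊗[k] W ≃ₗ[R] R ⊗[k] W) : S ⊗[k] W ≃ₗ[S] S ⊗[k] W :=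
  LinearEquiv.ofLinearMap (endBaseChange f g.toLinearMap) (endBaseChange f g.symm.toLinearMap)
    (by rw [← endBaseChange_comp, LinearEquiv.comp_symm, endBaseChange_one])
    (by rw [← endBaseChange_comp, LinearEquiv.symm_comp, endBaseChange_one])

theorem autBaseChange_rTensor (g : R ⊗[k] W ≃ₗ[R] R ⊗[k] W) (x : R ⊗[k] W) :
    autBaseChange f g (LinearMap.rTensor W f.toLinearMap x) =
      LinearMap.rTensor W f.toLinearMap (g x) :=
  endBaseChange_rTensor f g.toLinearMap x

theorem baseChange_rTensor (b : W →ₗ[k] W') (x : R ⊗[k] W) :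
    b.baseChange S (LinearMap.rTensor W f.toLinearMap x) =
      LinearMap.rTensor W' f.toLinearMap (b.baseChange R x) := by
  induction x with
  | zero => simp
  | add x y hx hy => simp only [map_add, hx, hy]
  | tmul a w => simp

theorem distrib_symm_rTensor (s : R ⊗[k] W) (t : R ⊗[k] W') :
    (AlgebraTensorModule.distribBaseChange k S W W').symm
        (LinearMap.rTensor W f.toLinearMap s ⊗ₜ[S] LinearMap.rTensor W' f.toLinearMap t) =
      LinearMap.rTensor (W ⊗[k] W') f.toLinearMap
        ((AlgebraTensorModule.distribBaseChange k R W W').symm (s ⊗ₜ[R] t)) := by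
  induction s with
  | zero => simp
  | add x y hx hy => simp only [map_add, TensorProduct.add_tmul, hx, hy]
  | tmul a w =>
    induction t with
    | zero => simp
    | add x y hx hy => simp only [map_add, TensorProduct.tmul_add, hx, hy]
    | tmul a' w' => simp

end endBaseChange

/-- The group `π^L(K/k)(R) = Aut^⊗(ω)(R)` of `R`-points of the Tannakian group scheme attached to
the fibre functor `ω : D_∞(K/k) → Vect(k)`, `(V, W, ψ) ↦ W`: families `g` of `R`-linear automorphisms
`g_X` of `R ⊗_k ω(X)` that are natural in `X` and compatible with tensor products and the unit
object. -/
def localNori (k K P : Type u) [Field k] [Field K] [Field P] [Algebra K P] [Algebra k P]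
    (R : Type u) [CommRing R] [Algebra k R] :
    Subgroup (∀ X : DInf k K P, R ⊗[k] X.W ≃ₗ[R] R ⊗[k] X.W) where
  carrier := {g |
    (∀ (X Y : DInf k K P) (f : X ⟶ Y) (x : R ⊗[k] X.W),
      g Y (f.b.baseChange R x) = f.b.baseChange R (g X x)) ∧
    (∀ (X Y : DInf k K P) (x : R ⊗[k] X.W) (y : R ⊗[k] Y.W),
      g (X ⊗ Y) ((AlgebraTensorModule.distribBaseChange k R X.W Y.W).symm (x ⊗ₜ[R] y)) =
        (AlgebraTensorModule.distribBaseChange k R X.W Y.W).symm (g X x ⊗ₜ[R] g Y y)) ∧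
    (∀ x, g (𝟙_ (DInf k K P)) x = x)}
  one_mem' := ⟨fun _ _ _ _ => rfl, fun _ _ _ _ => rfl, fun _ => rfl⟩
  mul_mem' {g h} hg hh := by
    refine ⟨fun X Y f x => ?_, fun X Y x y => ?_, fun x => ?_⟩
    · change g Y (h Y _) = _
      rw [hh.1, hg.1]; rfl
    · change g (X ⊗ Y) (h (X ⊗ Y) _) = _
      rw [hh.2.1, hg.2.1]; rfl
    · change g _ (h _ x) = x
      rw [hh.2.2, hg.2.2]
  inv_mem' {g} hg := by
    refine ⟨fun X Y f x => ?_, fun X Y x y => ?_, fun x => ?_⟩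
    · change (g Y).symm _ = _
      rw [LinearEquiv.symm_apply_eq, hg.1]
      exact congrArg _ ((g X).apply_symm_apply x).symm
    · change (g (X ⊗ Y)).symm _ = _
      rw [LinearEquiv.symm_apply_eq, hg.2.1]
      exact congrArg _ (congrArg₂ _ ((g X).apply_symm_apply x).symm
        ((g Y).apply_symm_apply y).symm)
    · change (g _).symm x = x
      rw [LinearEquiv.symm_apply_eq, hg.2.2]

namespace localNori

variable {k K P : Type u} [Field k] [Field K] [Field P] [Algebra K P] [Algebra k P]
  {R S : Type u} [CommRing R] [Algebra k R] [CommRing S] [Algebra k S]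

/-- Functoriality of `R ↦ π^L(K/k)(R)`: base change of automorphisms along `f : R → S`. -/
def map (f : R →ₐ[k] S) : localNori k K P R →* localNori k K P S where
  toFun g := ⟨fun X => autBaseChange f (g.1 X), by
    refine ⟨fun X Y φ x => ?_, fun X Y x y => ?_, fun x => ?_⟩
    · refine LinearMap.congr_fun (f := (autBaseChange f (g.1 Y)).toLinearMap ∘ₗ φ.b.baseChange S)
        (g := φ.b.baseChange S ∘ₗ (autBaseChange f (g.1 X)).toLinearMap)
        (ext_rTensor f fun x => ?_) x
      simp only [LinearMap.comp_apply, LinearEquiv.coe_coe, baseChange_rTensor,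
        autBaseChange_rTensor, g.2.1]
    · let d := AlgebraTensorModule.distribBaseChange k S X.W Y.W
      let A : S ⊗[k] X.W →ₗ[S] S ⊗[k] Y.W →ₗ[S] S ⊗[k] (X.W ⊗[k] Y.W) :=
        (TensorProduct.mk S (S ⊗[k] X.W) (S ⊗[k] Y.W)).compr₂
          ((autBaseChange f (g.1 (X ⊗ Y))).toLinearMap ∘ₗ d.symm.toLinearMap)
      let B : S ⊗[k] X.W →ₗ[S] S ⊗[k] Y.W →ₗ[S] S ⊗[k] (X.W ⊗[k] Y.W) :=
        ((TensorProduct.mk S (S ⊗[k] X.W) (S ⊗[k] Y.W)).compl₁₂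
          (autBaseChange f (g.1 X)).toLinearMap (autBaseChange f (g.1 Y)).toLinearMap).compr₂
            d.symm.toLinearMap
      have hAB : A = B := ext_rTensor f fun s => ext_rTensor f fun t => by
        change autBaseChange f (g.1 (X ⊗ Y))
            (d.symm (LinearMap.rTensor _ f.toLinearMap s ⊗ₜ[S] LinearMap.rTensor _ f.toLinearMap t)) =
          d.symm (autBaseChange f (g.1 X) (LinearMap.rTensor _ f.toLinearMap s) ⊗ₜ[S]
            autBaseChange f (g.1 Y) (LinearMap.rTensor _ f.toLinearMap t))
        rw [autBaseChange_rTensor, autBaseChange_rTensor, distrib_symm_rTensor,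
          distrib_symm_rTensor, ← g.2.2.1]
        exact autBaseChange_rTensor f _ _
      exact LinearMap.congr_fun₂ hAB x y
    · refine LinearMap.congr_fun (f := (autBaseChange f (g.1 (𝟙_ (DInf k K P)))).toLinearMap)
        (g := LinearMap.id) (ext_rTensor f fun x => ?_) x
      rw [LinearEquiv.coe_coe, autBaseChange_rTensor, g.2.2.2]; rfl⟩
  map_one' := Subtype.ext <| funext fun X => LinearEquiv.toLinearMap_injective <|
    endBaseChange_one f
  map_mul' g h := Subtype.ext <| funext fun X => LinearEquiv.toLinearMap_injective <|
    endBaseChange_comp f (g.1 X).toLinearMap (h.1 X).toLinearMap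

/-- The group functor `π^L(K/k)` is an affine scheme: it is represented by a commutative
`k`-algebra `A`, with universal point `g ∈ π^L(K/k)(A)`. -/
def IsAffineGroupScheme (k K P : Type u) [Field k] [Field K] [Field P] [Algebra K P] [Algebra k P] :
    Prop :=
  ∃ (A : CommAlgCat.{u} k) (g : localNori k K P A),
    ∀ (R : CommAlgCat.{u} k) (h : localNori k K P R), ∃! f : A →ₐ[k] R, map f g = h

/-- The group `Hom_k(π^L(K/k), 𝔾_m)`: homomorphisms of group functors on commutative `k`-algebras,
with pointwise multiplication. -/
def characters (k K P : Type u) [Field k] [Field K] [Field P] [Algebra K P] [Algebra k P] :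
    Subgroup (∀ R : CommAlgCat.{u} k, localNori k K P R →* Rˣ) where
  carrier := {χ | ∀ (R S : CommAlgCat.{u} k) (f : R →ₐ[k] S) (g : localNori k K P R),
    ((χ S (map f g) : Sˣ) : S) = f (χ R g : Rˣ)}
  one_mem' R S f g := by simp
  mul_mem' {χ χ'} h h' R S f g := by simp [h R S f g, h' R S f g]
  inv_mem' {χ} h R S f g := by
    have h1 : χ S (map f g) = Units.map (f : R →* S) (χ R g) := Units.ext (h R S f g)
    change (((χ S (map f g))⁻¹ : Sˣ) : S) = f (((χ R g)⁻¹ : Rˣ) : R)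
    rw [h1, ← map_inv]; rfl

end localNori

end

noncomputable section

/-!
The matrix coefficients `g ↦ ⟨ξ, g w⟩` of the points of `π^L(K/k)` form a `k`-algebra, because
`D_∞(K/k)` has direct sums, tensor products and duals. Points of `π^L(K/k)` can be glued along a
jointly injective family of ring homomorphisms as soon as their matrix coefficients can, so this
algebra carries a universal point and represents `π^L(K/k)`. In particular every character is a
matrix coefficient.

The two base changes of `ψ` along `P ⇉ P ⊗_K P` differ by a canonical point of `π^L(K/k)`, and a
subspace `U ⊆ ω(X)` that is stable under it underlies a subobject of `X`: slicing the stability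
condition by a `K`-linear form on `P` shows that `ψ⁻¹(P ⊗ U)` descends to a subspace of `V`.
Applied to the eigenspace of a character `χ` in an object of which `χ` is a matrix coefficient, this
gives an object with a nonzero linear form `ξ` on which the group acts through `χ`. The periods
`ξ(ψ(1 ⊗ v))` are then proportional over `K`, so `ξ` underlies a morphism onto some line
`(K, k, φ)`, and `χ` is the character of that line. Its character is trivial only if
`φ ⊗ 1 = 1 ⊗ φ` in `P ⊗_K P`, that is, `φ ∈ K^*`.
-/

/-! ### Base change of linear forms -/

section BaseChange

variable {R S T M N : Type*} [CommSemiring R] [CommSemiring S] [Algebra R S] [CommSemiring T]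
  [Algebra R T] [AddCommMonoid M] [Module R M] [AddCommMonoid N] [Module R N]

theorem inl_baseChange_eq_prodRight_symm_comp :
    (LinearMap.inl R M N).baseChange S =
      (TensorProduct.prodRight R S S M N).symm.toLinearMap ∘ₗ LinearMap.inl S _ _ := by
  ext; simp [LinearEquiv.eq_symm_apply]

theorem inr_baseChange_eq_prodRight_symm_comp :
    (LinearMap.inr R M N).baseChange S =
      (TensorProduct.prodRight R S S M N).symm.toLinearMap ∘ₗ LinearMap.inr S _ _ := by
  ext; simp [LinearEquiv.eq_symm_apply]

theorem dual_baseChange_rTensor (f : S →ₐ[R] T) (ξ : Module.Dual R M) (x : S ⊗[R] M) :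
    Module.Dual.baseChange T ξ (f.toLinearMap.rTensor M x) =
      f (Module.Dual.baseChange S ξ x) := by
  induction x with
  | zero => simp
  | add x y hx hy => simp only [map_add, hx, hy]
  | tmul a m => simp

theorem dual_baseChange_comp (b : M →ₗ[R] N) (ξ : Module.Dual R N) :
    Module.Dual.baseChange S (ξ ∘ₗ b) = Module.Dual.baseChange S ξ ∘ₗ b.baseChange S := by
  ext; simp

theorem dual_baseChange_distrib_symm (ξ : Module.Dual R M) (ξ' : Module.Dual R N)
    (x : S ⊗[R] M) (y : S ⊗[R] N) :
    Module.Dual.baseChange S (LinearMap.mul' R R ∘ₗ TensorProduct.map ξ ξ')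
        ((AlgebraTensorModule.distribBaseChange R S M N).symm (x ⊗ₜ[S] y)) =
      Module.Dual.baseChange S ξ x * Module.Dual.baseChange S ξ' y := by
  induction x with
  | zero => simp
  | add x y hx hy => simp only [map_add, TensorProduct.add_tmul, add_mul, hx, hy]
  | tmul a m =>
    induction y with
    | zero => simp
    | add x y hx hy => simp only [map_add, TensorProduct.tmul_add, mul_add, hx, hy]
    | tmul a' n => simp [mul_comm (ξ m), mul_smul]

theorem basis_baseChange_repr {ι : Type*} (b : Module.Basis ι R M) (x : S ⊗[R] M) (i : ι) :
    (b.baseChange S).repr x i = Module.Dual.baseChange S (b.coord i) x :=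
  LinearMap.congr_fun (f := (b.baseChange S).coord i) (by ext; simp) x

theorem ext_dual_baseChange [Module.Free R M] {x y : S ⊗[R] M}
    (h : ∀ ξ : Module.Dual R M, Module.Dual.baseChange S ξ x = Module.Dual.baseChange S ξ y) :
    x = y :=
  ((Module.Free.chooseBasis R M).baseChange S).ext_elem fun i => by
    rw [basis_baseChange_repr, basis_baseChange_repr, h]

end BaseChange

section DualBaseChange

variable {R M : Type*} (S : Type*) [CommRing R] [CommRing S] [Algebra R S] [AddCommGroup M]
  [Module R M] [Module.Free R M] [Module.Finite R M]

/-- The canonical isomorphism `S ⊗ M^* ≃ (S ⊗ M)^*`, which turns an element of `S ⊗ M^*` into a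
linear form that can be evaluated on `S ⊗ M`. -/
def dualBaseChange : S ⊗[R] Module.Dual R M ≃ₗ[S] Module.Dual S (S ⊗[R] M) :=
  (TensorProduct.isBaseChange R M S).toDualBaseChange

variable {S}

theorem dualBaseChange_tmul (a : S) (ξ : Module.Dual R M) :
    dualBaseChange S (a ⊗ₜ ξ) = a • Module.Dual.baseChange S ξ := by
  ext m
  simpa [dualBaseChange, Algebra.algebraMap_eq_smul_one] using
    (TensorProduct.isBaseChange R M S).toDualBaseChange_tmul a ξ m

theorem dualBaseChange_apply_one_tmul (t : S ⊗[R] Module.Dual R M) (m : M) :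
    dualBaseChange S t (1 ⊗ₜ m) = Module.Dual.baseChange S (Module.Dual.eval R M m) t := by
  induction t with
  | zero => simp
  | add s t hs ht => simp only [map_add, LinearMap.add_apply, hs, ht]
  | tmul a ξ => simp [dualBaseChange_tmul]

theorem contractLeft_baseChange_distrib_symm (t : S ⊗[R] Module.Dual R M) (x : S ⊗[R] M) :
    (contractLeft R M).baseChange S
        ((AlgebraTensorModule.distribBaseChange R S (Module.Dual R M) M).symm (t ⊗ₜ[S] x)) =
      dualBaseChange S t x ⊗ₜ 1 := by
  induction t with
  | zero => simp
  | add s t hs ht => simp only [map_add, TensorProduct.add_tmul, LinearMap.add_apply, hs, ht]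
  | tmul a ξ =>
    induction x with
    | zero => simp
    | add x y hx hy => simp only [map_add, TensorProduct.tmul_add, TensorProduct.add_tmul, hx, hy]
    | tmul b m => simp [dualBaseChange_tmul, TensorProduct.smul_tmul]

end DualBaseChange

section JointlyInjective

theorem ext_rTensor_of_jointly_injective {k R M ι : Type*} {T : ι → Type*} [CommSemiring k]
    [CommSemiring R] [Algebra k R] [∀ i, CommSemiring (T i)] [∀ i, Algebra k (T i)]
    [AddCommMonoid M] [Module k M] [Module.Free k M] (f : ∀ i, R →ₐ[k] T i)
    (hf : ∀ a b, (∀ i, f i a = f i b) → a = b) {x y : R ⊗[k] M}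
    (h : ∀ i, (f i).toLinearMap.rTensor M x = (f i).toLinearMap.rTensor M y) : x = y :=
  ext_dual_baseChange fun ξ => hf _ _ fun i => by
    rw [← dual_baseChange_rTensor, ← dual_baseChange_rTensor, h]

variable {k R W : Type u} {ι : Type*} {T : ι → Type u} [Field k] [CommRing R] [Algebra k R]
  [∀ i, CommRing (T i)] [∀ i, Algebra k (T i)] [AddCommGroup W] [Module k W]
  (f : ∀ i, R →ₐ[k] T i)

theorem endBaseChange_jointly_injective (hf : ∀ a b, (∀ i, f i a = f i b) → a = b)
    {G G' : R ⊗[k] W →ₗ[R] R ⊗[k] W} (h : ∀ i, endBaseChange (f i) G = endBaseChange (f i) G') :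
    G = G' :=
  LinearMap.ext fun x => ext_rTensor_of_jointly_injective f hf fun i => by
    rw [← endBaseChange_rTensor, ← endBaseChange_rTensor, h]

theorem exists_endBaseChange_eq [Module.Finite k W] (H : ∀ i, T i ⊗[k] W →ₗ[T i] T i ⊗[k] W)
    (hH : ∀ (w : W) (ξ : Module.Dual k W), ∃ a : R, ∀ i,
      f i a = Module.Dual.baseChange (T i) ξ (H i (1 ⊗ₜ w))) :
    ∃ G : R ⊗[k] W →ₗ[R] R ⊗[k] W, ∀ i, endBaseChange (f i) G = H i := by
  let b := Module.finBasis k W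
  choose a ha using hH
  let G : R ⊗[k] W →ₗ[R] R ⊗[k] W := (b.baseChange R).constr R fun j =>
    (b.baseChange R).equivFun.symm fun l => a (b j) (b.coord l)
  have coord_G (j l) : Module.Dual.baseChange R (b.coord l) (G (1 ⊗ₜ b j)) =
      a (b j) (b.coord l) := by
    rw [← basis_baseChange_repr, ← Module.Basis.baseChange_apply, Module.Basis.constr_basis,
      ← Module.Basis.equivFun_apply, LinearEquiv.apply_symm_apply]
  refine ⟨G, fun i => (b.baseChange (T i)).ext fun j => (b.baseChange (T i)).ext_elem fun l => ?_⟩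
  have one_tmul : (1 : T i) ⊗ₜ b j = (f i).toLinearMap.rTensor W (1 ⊗ₜ b j) := by simp
  rw [basis_baseChange_repr, basis_baseChange_repr, Module.Basis.baseChange_apply, ← ha,
    one_tmul, endBaseChange_rTensor, dual_baseChange_rTensor, coord_G]

end JointlyInjective

/-! ### Direct sums and duals -/

namespace DInf

variable {k K P : Type u} [Field k] [Field K] [Field P] [Algebra K P] [Algebra k P]

/-- The direct sum `(V × V', W × W', ψ × ψ')`. -/
abbrev prod (X Y : DInf k K P) : DInf k K P where
  V := X.V × Y.V
  W := X.W × Y.W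
  ψ := TensorProduct.prodRight K P P X.V Y.V ≪≫ₗ
    LinearEquiv.prodCongr X.ψ Y.ψ ≪≫ₗ (TensorProduct.prodRight k P P X.W Y.W).symm

/-- The inclusion of the first summand of `prod X Y`. -/
def inl (X Y : DInf k K P) : X ⟶ prod X Y where
  a := LinearMap.inl K X.V Y.V
  b := LinearMap.inl k X.W Y.W
  comm := by
    ext v
    simp [inl_baseChange_eq_prodRight_symm_comp]

/-- The inclusion of the second summand of `prod X Y`. -/
def inr (X Y : DInf k K P) : Y ⟶ prod X Y where
  a := LinearMap.inr K X.V Y.V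
  b := LinearMap.inr k X.W Y.W
  comm := by
    ext v
    simp [inr_baseChange_eq_prodRight_symm_comp]

/-- The dual object `(V^*, W^*, (ψ^*)⁻¹)`. -/
abbrev dual (X : DInf k K P) : DInf k K P where
  V := Module.Dual K X.V
  W := Module.Dual k X.W
  ψ := dualBaseChange P ≪≫ₗ X.ψ.symm.dualMap ≪≫ₗ (dualBaseChange P).symm

theorem dualBaseChange_dual_ψ (X : DInf k K P) (ξ : P ⊗[K] Module.Dual K X.V) (x : P ⊗[K] X.V) :
    dualBaseChange P ((dual X).ψ ξ) (X.ψ x) = dualBaseChange P ξ x := by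
  simp

/-- The evaluation `X^* ⊗ X ⟶ 𝟙`. -/
def evaluation (X : DInf k K P) : dual X ⊗ X ⟶ 𝟙_ (DInf k K P) where
  a := contractLeft K X.V
  b := contractLeft k X.W
  comm := baseChange_tensor_ext fun ξ v => by
    change (line k K (1 : Pˣ)).ψ (1 ⊗ₜ ξ v) = (contractLeft k X.W).baseChange P
      (tensorψ (dual X) X (1 ⊗ₜ[K] (ξ ⊗ₜ[K] v)))
    rw [tensorψ_tmul, contractLeft_baseChange_distrib_symm, dualBaseChange_dual_ψ,
      dualBaseChange_tmul, line_ψ_tmul]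
    simp

/-- Transport of the structure of an object along linear isomorphisms. -/
abbrev ofEquiv (X : DInf k K P) {V W : Type u} [AddCommGroup V] [Module K V] [Module.Finite K V]
    [AddCommGroup W] [Module k W] [Module.Finite k W] (a : X.V ≃ₗ[K] V) (b : X.W ≃ₗ[k] W) :
    DInf k K P where
  V := V
  W := W
  ψ := (a.baseChange K P X.V V).symm ≪≫ₗ X.ψ ≪≫ₗ b.baseChange k P X.W W

/-- The tautological isomorphism from an object to its transport along linear isomorphisms. -/
def isoOfEquiv (X : DInf k K P) {V W : Type u} [AddCommGroup V] [Module K V] [Module.Finite K V]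
    [AddCommGroup W] [Module k W] [Module.Finite k W] (a : X.V ≃ₗ[K] V) (b : X.W ≃ₗ[k] W) :
    X ≅ X.ofEquiv a b :=
  mkIso a b (LinearMap.ext fun x => congrArg (fun y => b.baseChange k P X.W W (X.ψ y))
    ((a.baseChange K P X.V V).symm_apply_apply x))

instance : EssentiallySmall.{u} (DInf k K P) := by
  refine essentiallySmall_iff _ |>.2 ⟨?_, inferInstance⟩
  let standard : (Σ m n : ℕ, P ⊗[K] (Fin m → K) ≃ₗ[P] P ⊗[k] (Fin n → k)) →
      Skeleton (DInf k K P) :=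
    fun s => toSkeleton { V := Fin s.1 → K, W := Fin s.2.1 → k, ψ := s.2.2 }
  refine small_of_surjective (f := standard) fun L => ?_
  obtain ⟨X, rfl⟩ : ∃ X, toSkeleton X = L := Quotient.exists_rep L
  let bV := Module.finBasis K X.V
  let bW := Module.finBasis k X.W
  exact ⟨⟨_, _, (X.ofEquiv bV.equivFun bW.equivFun).ψ⟩,
    toSkeleton_eq_toSkeleton_iff.2 ⟨(X.isoOfEquiv bV.equivFun bW.equivFun).symm⟩⟩

end DInf

/-! ### Matrix coefficients and the coordinate ring -/

namespace localNori

open DInf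

variable {k K P : Type u} [Field k] [Field K] [Field P] [Algebra K P] [Algebra k P]

section Coefficients

variable {R S : Type u} [CommRing R] [Algebra k R] [CommRing S] [Algebra k S]

theorem apply_hom (g : localNori k K P R) {X Y : DInf k K P} (f : X ⟶ Y) (x : R ⊗[k] X.W) :
    g.1 Y (f.b.baseChange R x) = f.b.baseChange R (g.1 X x) :=
  g.2.1 X Y f x

theorem apply_tensor (g : localNori k K P R) (X Y : DInf k K P) (x : R ⊗[k] X.W)
    (y : R ⊗[k] Y.W) :
    g.1 (X ⊗ Y) ((AlgebraTensorModule.distribBaseChange k R X.W Y.W).symm (x ⊗ₜ[R] y)) =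
      (AlgebraTensorModule.distribBaseChange k R X.W Y.W).symm (g.1 X x ⊗ₜ[R] g.1 Y y) :=
  g.2.2.1 X Y x y

theorem apply_unit (g : localNori k K P R) (x : R ⊗[k] (𝟙_ (DInf k K P)).W) :
    g.1 (𝟙_ (DInf k K P)) x = x :=
  g.2.2.2 x

theorem map_apply_rTensor (f : R →ₐ[k] S) (g : localNori k K P R) (X : DInf k K P)
    (x : R ⊗[k] X.W) :
    (map f g).1 X (f.toLinearMap.rTensor X.W x) = f.toLinearMap.rTensor X.W (g.1 X x) :=
  autBaseChange_rTensor f _ _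

/-- The matrix coefficient `w ↦ ⟨ξ, g w⟩` of a point `g` of `π^L(K/k)`. -/
def coeff (g : localNori k K P R) (X : DInf k K P) (ξ : Module.Dual k X.W) : X.W →ₗ[k] R :=
  (Module.Dual.baseChange R ξ).restrictScalars k ∘ₗ
    (g.1 X).toLinearMap.restrictScalars k ∘ₗ TensorProduct.mk k R X.W 1

theorem coeff_apply (g : localNori k K P R) (X : DInf k K P) (ξ : Module.Dual k X.W) (w : X.W) :
    coeff g X ξ w = Module.Dual.baseChange R ξ (g.1 X (1 ⊗ₜ w)) :=
  rfl

theorem coeff_map (f : R →ₐ[k] S) (g : localNori k K P R) (X : DInf k K P)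
    (ξ : Module.Dual k X.W) (w : X.W) : coeff (map f g) X ξ w = f (coeff g X ξ w) := by
  have one_tmul : (1 : S) ⊗ₜ[k] w = f.toLinearMap.rTensor X.W (1 ⊗ₜ w) := by simp
  rw [coeff_apply, one_tmul, map_apply_rTensor, dual_baseChange_rTensor, coeff_apply]

theorem coeff_hom (g : localNori k K P R) {X Y : DInf k K P} (f : X ⟶ Y)
    (ξ : Module.Dual k Y.W) (w : X.W) : coeff g Y ξ (f.b w) = coeff g X (ξ ∘ₗ f.b) w := by
  rw [coeff_apply, coeff_apply, dual_baseChange_comp, LinearMap.comp_apply, ← apply_hom,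
    LinearMap.baseChange_tmul]

theorem coeff_prod (g : localNori k K P R) (X Y : DInf k K P) (ξ : Module.Dual k X.W)
    (ξ' : Module.Dual k Y.W) (w : X.W) (w' : Y.W) :
    coeff g (prod X Y) (ξ.coprod ξ') (w, w') = coeff g X ξ w + coeff g Y ξ' w' := by
  have decomposition : (w, w') = (inl X Y).b w + (inr X Y).b w' := by simp [inl, inr]
  have restrict_inl : ξ.coprod ξ' ∘ₗ (inl X Y).b = ξ := LinearMap.coprod_inl ξ ξ'
  have restrict_inr : ξ.coprod ξ' ∘ₗ (inr X Y).b = ξ' := LinearMap.coprod_inr ξ ξ'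
  rw [decomposition, map_add, coeff_hom, coeff_hom, restrict_inl, restrict_inr]

theorem coeff_tensor (g : localNori k K P R) (X Y : DInf k K P) (ξ : Module.Dual k X.W)
    (ξ' : Module.Dual k Y.W) (w : X.W) (w' : Y.W) :
    coeff g (X ⊗ Y) (LinearMap.mul' k k ∘ₗ TensorProduct.map ξ ξ') (w ⊗ₜ[k] w') =
      coeff g X ξ w * coeff g Y ξ' w' := by
  have h := apply_tensor g X Y (1 ⊗ₜ w) (1 ⊗ₜ w')
  rw [AlgebraTensorModule.distribBaseChange_symm_tmul, mul_one] at h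
  exact (congrArg _ h).trans (dual_baseChange_distrib_symm ξ ξ' _ _)

theorem coeff_unit (g : localNori k K P R) (c : k) :
    coeff g (𝟙_ (DInf k K P)) LinearMap.id c = algebraMap k R c := by
  rw [coeff_apply, apply_unit]
  exact (Module.Dual.baseChange_apply_tmul R LinearMap.id 1 c).trans
    (Algebra.algebraMap_eq_smul_one c).symm

theorem dualBaseChange_apply_apply (g : localNori k K P R) (X : DInf k K P)
    (ξ : R ⊗[k] (dual X).W) (x : R ⊗[k] X.W) :
    dualBaseChange R (g.1 (dual X) ξ) (g.1 X x) = dualBaseChange R ξ x := by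
  have contract (η : R ⊗[k] (dual X).W) (y : R ⊗[k] X.W) :
      (evaluation X).b.baseChange R
        ((AlgebraTensorModule.distribBaseChange k R (dual X).W X.W).symm (η ⊗ₜ[R] y)) =
          dualBaseChange R η y ⊗ₜ[k] (1 : k) :=
    contractLeft_baseChange_distrib_symm η y
  have invariance : dualBaseChange R (g.1 (dual X) ξ) (g.1 X x) ⊗ₜ[k] (1 : k) =
      dualBaseChange R ξ x ⊗ₜ[k] (1 : k) := by
    rw [← contract, ← contract, ← apply_tensor, ← apply_hom, apply_unit]
  simpa using congrArg (TensorProduct.rid k R) invariance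

theorem coeff_inv (g : localNori k K P R) (X : DInf k K P) (ξ : Module.Dual k X.W) (w : X.W) :
    coeff g⁻¹ X ξ w = coeff g (dual X) (Module.Dual.eval k X.W w) ξ := by
  have apply_inv : g.1 X (g⁻¹.1 X (1 ⊗ₜ w)) = 1 ⊗ₜ w := (g.1 X).apply_symm_apply _
  rw [coeff_apply, coeff_apply, ← dualBaseChange_apply_one_tmul, ← apply_inv,
    dualBaseChange_apply_apply, dualBaseChange_tmul, one_smul, apply_inv]

end Coefficients

section UniversalPoint

variable {A : Type u} {ι : Type*} {T : ι → Type u} [CommRing A] [Algebra k A]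
  [∀ i, CommRing (T i)] [∀ i, Algebra k (T i)] {ev : ∀ i, A →ₐ[k] T i}
  {h : ∀ i, localNori k K P (T i)}

theorem exists_autBaseChange_eq (hinj : ∀ a b, (∀ i, ev i a = ev i b) → a = b)
    (hev : ∀ (X : DInf k K P) (ξ : Module.Dual k X.W) (w : X.W),
      ∃ a : A, ∀ i, ev i a = coeff (h i) X ξ w) (X : DInf k K P) :
    ∃ G : A ⊗[k] X.W ≃ₗ[A] A ⊗[k] X.W, ∀ i, autBaseChange (ev i) G = (h i).1 X := by
  obtain ⟨G, hG⟩ := exists_endBaseChange_eq ev (fun i => ((h i).1 X).toLinearMap)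
    fun w ξ => hev X ξ w
  obtain ⟨H, hH⟩ := exists_endBaseChange_eq ev (fun i => ((h i)⁻¹.1 X).toLinearMap)
    fun w ξ => by
      simp_rw [LinearEquiv.coe_coe, ← coeff_apply, coeff_inv]
      exact hev (dual X) (Module.Dual.eval k X.W w) ξ
  have G_comp_H : G ∘ₗ H = LinearMap.id := endBaseChange_jointly_injective ev hinj fun i => by
    rw [endBaseChange_comp, endBaseChange_one, hG, hH]
    exact ((h i).1 X).comp_symm
  have H_comp_G : H ∘ₗ G = LinearMap.id := endBaseChange_jointly_injective ev hinj fun i => by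
    rw [endBaseChange_comp, endBaseChange_one, hG, hH]
    exact ((h i).1 X).symm_comp
  exact ⟨LinearEquiv.ofLinearMap G H G_comp_H H_comp_G,
    fun i => LinearEquiv.toLinearMap_injective (hG i)⟩

theorem exists_map_eq_of_coeff (hinj : ∀ a b, (∀ i, ev i a = ev i b) → a = b)
    (hev : ∀ (X : DInf k K P) (ξ : Module.Dual k X.W) (w : X.W),
      ∃ a : A, ∀ i, ev i a = coeff (h i) X ξ w) :
    ∃ g : localNori k K P A, ∀ i, map (ev i) g = h i := by
  choose G hG using exists_autBaseChange_eq hinj hev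
  have rTensor_G (X : DInf k K P) (i) (x : A ⊗[k] X.W) :
      (ev i).toLinearMap.rTensor X.W (G X x) = (h i).1 X ((ev i).toLinearMap.rTensor X.W x) := by
    rw [← autBaseChange_rTensor, hG]
  have rTensor_distrib_symm (X Y : DInf k K P) (i) (x : A ⊗[k] X.W) (y : A ⊗[k] Y.W) :
      (ev i).toLinearMap.rTensor (X ⊗ Y).W
          ((AlgebraTensorModule.distribBaseChange k A X.W Y.W).symm (x ⊗ₜ[A] y)) =
        (AlgebraTensorModule.distribBaseChange k (T i) X.W Y.W).symm
          ((ev i).toLinearMap.rTensor X.W x ⊗ₜ[T i] (ev i).toLinearMap.rTensor Y.W y) :=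
    (distrib_symm_rTensor (ev i) x y).symm
  refine ⟨⟨G, fun X Y f x => ?_, fun X Y x y => ?_, fun x => ?_⟩,
    fun i => Subtype.ext (funext fun X => hG X i)⟩ <;>
    refine ext_rTensor_of_jointly_injective ev hinj fun i => ?_
  · rw [rTensor_G, ← baseChange_rTensor, apply_hom, ← baseChange_rTensor, rTensor_G]
  · rw [rTensor_G, rTensor_distrib_symm, rTensor_distrib_symm, apply_tensor, rTensor_G, rTensor_G]
  · rw [rTensor_G, apply_unit]

end UniversalPoint

variable (k K P) in
/-- The algebra of those functions on the points of `π^L(K/k)` that are matrix coefficients. -/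
def matrixCoeffs : Subalgebra k (∀ x : Σ R : CommAlgCat.{u} k, localNori k K P R, x.1) where
  carrier := {F | ∃ (X : DInf k K P) (ξ : Module.Dual k X.W) (w : X.W),
    ∀ x, F x = coeff x.2 X ξ w}
  algebraMap_mem' c := ⟨𝟙_ _, LinearMap.id, c, fun x => (coeff_unit x.2 c).symm⟩
  add_mem' := by
    rintro _ _ ⟨X, ξ, w, hF⟩ ⟨Y, η, w', hG⟩
    exact ⟨prod X Y, ξ.coprod η, (w, w'), fun x => by rw [coeff_prod, ← hF, ← hG]; rfl⟩
  mul_mem' := by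
    rintro _ _ ⟨X, ξ, w, hF⟩ ⟨Y, η, w', hG⟩
    exact ⟨X ⊗ Y, LinearMap.mul' k k ∘ₗ TensorProduct.map ξ η, w ⊗ₜ w',
      fun x => by rw [coeff_tensor, ← hF, ← hG]; rfl⟩

instance : Small.{u} (matrixCoeffs k K P) := by
  let e := equivSmallModel.{u} (DInf k K P)
  let ofSmall (s : Σ s : SmallModel.{u} (DInf k K P),
      Module.Dual k (e.inverse.obj s).W × (e.inverse.obj s).W) : matrixCoeffs k K P :=
    ⟨fun x => coeff x.2 _ s.2.1 s.2.2, _, s.2.1, s.2.2, fun _ => rfl⟩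
  refine small_of_surjective (f := ofSmall) ?_
  rintro ⟨F, X, ξ, w, hF⟩
  let i : X ≅ e.inverse.obj (e.functor.obj X) := e.unitIso.app X
  refine ⟨⟨e.functor.obj X, ξ ∘ₗ i.inv.b, i.hom.b w⟩, Subtype.ext (funext fun x => ?_)⟩
  have cancel : (ξ ∘ₗ i.inv.b) ∘ₗ i.hom.b = ξ := by
    rw [LinearMap.comp_assoc, ← comp_b, i.hom_inv_id, id_b, LinearMap.comp_id]
  refine (coeff_hom x.2 i.hom _ w).trans ?_
  rw [cancel]
  exact (hF x).symm

variable (k K P) in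
/-- The coordinate ring of `π^L(K/k)`, a model of `matrixCoeffs k K P` in the universe of `k`. -/
def CoordRing : Type u := Shrink.{u} (matrixCoeffs k K P)

instance : CommRing (CoordRing k K P) :=
  inferInstanceAs (CommRing (Shrink.{u} (matrixCoeffs k K P)))

instance : Algebra k (CoordRing k K P) :=
  inferInstanceAs (Algebra k (Shrink.{u} (matrixCoeffs k K P)))

variable (k K P) in
/-- The identification of the elements of the coordinate ring with functions on the points. -/
def coordRingEquiv : CoordRing k K P ≃ₐ[k] matrixCoeffs k K P :=
  Shrink.algEquiv k (matrixCoeffs k K P)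

/-- The value of the functions in the coordinate ring at a point of `π^L(K/k)`. -/
def evalAt {R : CommAlgCat.{u} k} (g : localNori k K P R) : CoordRing k K P →ₐ[k] R :=
  ((Pi.evalAlgHom k (fun x : Σ R : CommAlgCat.{u} k, localNori k K P R => x.1) ⟨R, g⟩).comp
    (matrixCoeffs k K P).val).comp (coordRingEquiv k K P).toAlgHom

theorem ext_evalAt {a b : CoordRing k K P}
    (h : ∀ (R : CommAlgCat.{u} k) (g : localNori k K P R), evalAt g a = evalAt g b) : a = b :=
  (coordRingEquiv k K P).injective (Subtype.ext (funext fun x => h x.1 x.2))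

theorem exists_evalAt_eq_coeff (X : DInf k K P) (ξ : Module.Dual k X.W) (w : X.W) :
    ∃ a : CoordRing k K P, ∀ (R : CommAlgCat.{u} k) (g : localNori k K P R),
      evalAt g a = coeff g X ξ w :=
  ⟨(coordRingEquiv k K P).symm ⟨fun x => coeff x.2 X ξ w, X, ξ, w, fun _ => rfl⟩,
    fun R g => by simp [evalAt]⟩

theorem exists_coeff_eq_evalAt (a : CoordRing k K P) :
    ∃ (X : DInf k K P) (ξ : Module.Dual k X.W) (w : X.W),
      ∀ (R : CommAlgCat.{u} k) (g : localNori k K P R), evalAt g a = coeff g X ξ w := by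
  obtain ⟨X, ξ, w, h⟩ := (coordRingEquiv k K P a).2
  exact ⟨X, ξ, w, fun R g => h ⟨R, g⟩⟩

variable (k K P) in
theorem exists_universal_point : ∃ g : localNori k K P (CoordRing k K P),
    ∀ (R : CommAlgCat.{u} k) (h : localNori k K P R), map (evalAt h) g = h := by
  obtain ⟨g, hg⟩ := exists_map_eq_of_coeff (ι := Σ R : CommAlgCat.{u} k, localNori k K P R)
    (T := fun x => x.1) (ev := fun x => evalAt x.2) (h := fun x => x.2)
    (fun a b hab => ext_evalAt fun R g => hab ⟨R, g⟩)
    (fun X ξ w => (exists_evalAt_eq_coeff X ξ w).imp fun a ha x => ha x.1 x.2)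
  exact ⟨g, fun R h => hg ⟨R, h⟩⟩

variable (k K P) in
theorem isAffineGroupScheme : IsAffineGroupScheme k K P := by
  obtain ⟨g, hg⟩ := exists_universal_point k K P
  refine ⟨CommAlgCat.of k (CoordRing k K P), g, fun R h => ⟨evalAt h, hg R h, ?_⟩⟩
  rintro f rfl
  refine AlgHom.ext fun a => ?_
  obtain ⟨X, ξ, w, ha⟩ := exists_coeff_eq_evalAt a
  have a_eq : a = coeff g X ξ w := ext_evalAt fun S x => by rw [ha, ← coeff_map, hg]
  rw [ha, coeff_map, ← a_eq]

theorem exists_coeff_eq_character (χ : characters k K P) :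
    ∃ (X : DInf k K P) (ξ : Module.Dual k X.W) (w : X.W),
      ∀ (R : CommAlgCat.{u} k) (g : localNori k K P R), (χ.1 R g : R) = coeff g X ξ w := by
  obtain ⟨g, hg⟩ := exists_universal_point k K P
  obtain ⟨X, ξ, w, h⟩ := exists_coeff_eq_evalAt (χ.1 (CommAlgCat.of k (CoordRing k K P)) g).1
  refine ⟨X, ξ, w, fun R x => ?_⟩
  rw [← h, ← χ.2 (CommAlgCat.of k (CoordRing k K P)) R (evalAt x) g, hg]

end localNori

/-! ### Points from pairs of homomorphisms -/

theorem cancelBaseChange_one_tmul {R A B M : Type*} [CommSemiring R] [CommSemiring A]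
    [Algebra R A] [CommSemiring B] [Algebra R B] [Algebra A B] [IsScalarTower R A B]
    [AddCommMonoid M] [Module R M] (x : A ⊗[R] M) :
    AlgebraTensorModule.cancelBaseChange R A B B M (1 ⊗ₜ x) =
      (IsScalarTower.toAlgHom R A B).toLinearMap.rTensor M x := by
  induction x with
  | zero => simp
  | add x y hx hy => simp only [TensorProduct.tmul_add, map_add, hx, hy]
  | tmul a m => simp [Algebra.algebraMap_eq_smul_one]

namespace DInf

variable {k K P : Type u} [Field k] [Field K] [Field P] [Algebra K P] [Algebra k P]

theorem tensorψ_distrib_symm (X Y : DInf k K P) (x : P ⊗[K] X.V) (y : P ⊗[K] Y.V) :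
    tensorψ X Y ((AlgebraTensorModule.distribBaseChange K P X.V Y.V).symm (x ⊗ₜ[P] y)) =
      (AlgebraTensorModule.distribBaseChange k P X.W Y.W).symm (X.ψ x ⊗ₜ[P] Y.ψ y) := by
  simp [tensorψ]

variable [Algebra k K] [IsScalarTower k K P]
  {S : Type u} [CommRing S] [Algebra k S] [Algebra K S] [IsScalarTower k K S]

/-- The base change of `ψ` along a homomorphism `f : P → S`. -/
def pullback (f : P →ₐ[K] S) (X : DInf k K P) : S ⊗[K] X.V ≃ₗ[S] S ⊗[k] X.W :=
  letI := f.toAlgebra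
  haveI : IsScalarTower K P S := .of_algHom f
  haveI : IsScalarTower k P S := .of_algHom (f.restrictScalars k)
  (AlgebraTensorModule.cancelBaseChange K P S S X.V).symm ≪≫ₗ
    X.ψ.baseChange P S _ _ ≪≫ₗ AlgebraTensorModule.cancelBaseChange k P S S X.W

theorem pullback_rTensor (f : P →ₐ[K] S) (X : DInf k K P) (x : P ⊗[K] X.V) :
    pullback f X (f.toLinearMap.rTensor X.V x) =
      (f.restrictScalars k).toLinearMap.rTensor X.W (X.ψ x) := by
  let _ := f.toAlgebra
  have : IsScalarTower K P S := .of_algHom f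
  have : IsScalarTower k P S := .of_algHom (f.restrictScalars k)
  refine Eq.trans ?_ (cancelBaseChange_one_tmul (R := k) (B := S) (X.ψ x))
  have cancel_symm : (AlgebraTensorModule.cancelBaseChange K P S S X.V).symm
      (f.toLinearMap.rTensor X.V x) = 1 ⊗ₜ x :=
    (LinearEquiv.symm_apply_eq _).2 (cancelBaseChange_one_tmul x).symm
  exact congrArg (AlgebraTensorModule.cancelBaseChange k P S S X.W ∘ X.ψ.baseChange P S _ _)
    cancel_symm

theorem pullback_hom (f : P →ₐ[K] S) {X Y : DInf k K P} (φ : X ⟶ Y) (x : S ⊗[K] X.V) :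
    pullback f Y (φ.a.baseChange S x) = φ.b.baseChange S (pullback f X x) := by
  refine LinearMap.congr_fun (f := (pullback f Y).toLinearMap ∘ₗ φ.a.baseChange S)
    (g := φ.b.baseChange S ∘ₗ (pullback f X).toLinearMap) (ext_rTensor f fun x => ?_) x
  simp only [LinearMap.comp_apply, LinearEquiv.coe_coe, baseChange_rTensor, pullback_rTensor,
    φ.comm_apply]

theorem pullback_tensor (f : P →ₐ[K] S) (X Y : DInf k K P) (x : S ⊗[K] X.V) (y : S ⊗[K] Y.V) :
    pullback f (X ⊗ Y) ((AlgebraTensorModule.distribBaseChange K S X.V Y.V).symm (x ⊗ₜ[S] y)) =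
      (AlgebraTensorModule.distribBaseChange k S X.W Y.W).symm
        (pullback f X x ⊗ₜ[S] pullback f Y y) := by
  refine LinearMap.congr_fun₂
    (f := (TensorProduct.mk S (S ⊗[K] X.V) (S ⊗[K] Y.V)).compr₂
      ((pullback f (X ⊗ Y)).toLinearMap ∘ₗ
        (AlgebraTensorModule.distribBaseChange K S X.V Y.V).symm.toLinearMap))
    (g := ((TensorProduct.mk S (S ⊗[k] X.W) (S ⊗[k] Y.W)).compl₁₂
      (pullback f X).toLinearMap (pullback f Y).toLinearMap).compr₂
        (AlgebraTensorModule.distribBaseChange k S X.W Y.W).symm.toLinearMap)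
    (ext_rTensor f fun s => ext_rTensor f fun t => ?_) x y
  change pullback f (X ⊗ Y) ((AlgebraTensorModule.distribBaseChange K S X.V Y.V).symm
      (f.toLinearMap.rTensor _ s ⊗ₜ[S] f.toLinearMap.rTensor _ t)) =
    (AlgebraTensorModule.distribBaseChange k S X.W Y.W).symm
      (pullback f X (f.toLinearMap.rTensor _ s) ⊗ₜ[S] pullback f Y (f.toLinearMap.rTensor _ t))
  rw [distrib_symm_rTensor, pullback_rTensor, pullback_rTensor, distrib_symm_rTensor,
    ← tensorψ_distrib_symm]
  exact pullback_rTensor f (X ⊗ Y) _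

theorem pullback_line (f : P →ₐ[K] S) (φ : Pˣ) :
    pullback f (line k K φ) (1 ⊗ₜ[K] (1 : K)) = f φ ⊗ₜ[k] (1 : k) := by
  have h := pullback_rTensor f (line k K φ) (1 ⊗ₜ[K] (1 : K))
  rw [line_ψ_tmul] at h
  simpa using h

end DInf

namespace localNori

open DInf

variable {k K P : Type u} [Field k] [Field K] [Field P] [Algebra K P] [Algebra k P]
  [Algebra k K] [IsScalarTower k K P]
  {S : Type u} [CommRing S] [Algebra k S] [Algebra K S] [IsScalarTower k K S]

/-- The point of `π^L(K/k)` that compares the base changes of `ψ` along two homomorphisms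
`f₁, f₂ : P → S`. -/
def ofPair (f₁ f₂ : P →ₐ[K] S) : localNori k K P S :=
  ⟨fun X => (pullback f₂ X).symm ≪≫ₗ pullback f₁ X, by
    refine ⟨fun X Y φ x => ?_, fun X Y x y => ?_, fun x => ?_⟩
    · obtain ⟨x, rfl⟩ := (pullback f₂ X).surjective x
      simp only [← pullback_hom, LinearEquiv.trans_apply, LinearEquiv.symm_apply_apply]
    · obtain ⟨x, rfl⟩ := (pullback f₂ X).surjective x
      obtain ⟨y, rfl⟩ := (pullback f₂ Y).surjective y
      simp only [← pullback_tensor, LinearEquiv.trans_apply, LinearEquiv.symm_apply_apply]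
    · have symm_one (f : P →ₐ[K] S) :
          (pullback f (line k K 1)).symm (1 ⊗ₜ[k] (1 : k)) = 1 ⊗ₜ[K] (1 : K) := by
        rw [LinearEquiv.symm_apply_eq, pullback_line, Units.val_one, map_one]
      rw [LinearEquiv.trans_apply, ← LinearEquiv.eq_symm_apply]
      refine LinearMap.congr_fun (f := (pullback f₂ (line k K 1)).symm.toLinearMap)
        (g := (pullback f₁ (line k K 1)).symm.toLinearMap) ?_ x
      ext
      exact (symm_one f₂).trans (symm_one f₁).symm⟩

theorem ofPair_pullback (f₁ f₂ : P →ₐ[K] S) (X : DInf k K P) (x : S ⊗[K] X.V) :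
    (ofPair f₁ f₂).1 X (pullback f₂ X x) = pullback f₁ X x :=
  congrArg (pullback f₁ X) ((pullback f₂ X).symm_apply_apply x)

end localNori

/-! ### Descent of subobjects -/

section Slice

variable {R A B M : Type*} [CommSemiring R] [CommSemiring A] [Algebra R A] [CommSemiring B]
  [Algebra R B] [AddCommMonoid M] [Module R M]

/-- The slice `μ ⊗ id : A ⊗ M → M` of tensors along a linear form `μ` on `A`. -/
def slice (μ : Module.Dual R A) : A ⊗[R] M →ₗ[R] M :=
  TensorProduct.lid R M ∘ₗ μ.rTensor M

@[simp]
theorem slice_tmul (μ : Module.Dual R A) (a : A) (m : M) : slice μ (a ⊗ₜ[R] m) = μ a • m := rfl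

theorem dual_slice (μ : Module.Dual R A) (ξ : Module.Dual R M) (x : A ⊗[R] M) :
    ξ (slice μ x) = μ (Module.Dual.baseChange A ξ x) := by
  induction x with
  | zero => simp
  | add x y hx hy => simp only [map_add, hx, hy]
  | tmul a m => simp [mul_comm]

theorem mem_baseChange_of_slice_mem [Module.Free R A] {N : Submodule R M} {x : A ⊗[R] M}
    (h : ∀ μ : Module.Dual R A, slice μ x ∈ N) : x ∈ N.baseChange A := by
  classical
  let b := Module.Free.chooseBasis R A
  rw [← (TensorProduct.equivFinsuppOfBasisLeft b).symm_apply_apply x,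
    TensorProduct.equivFinsuppOfBasisLeft_symm_apply]
  refine Submodule.sum_mem _ fun i _ => Submodule.tmul_mem_baseChange_of_mem _ ?_
  rw [TensorProduct.equivFinsuppOfBasisLeft_apply]
  exact h (b.coord i)

theorem rTensor_mem_baseChange (ν : A →ₗ[R] B) {N : Submodule R M} {x : A ⊗[R] M}
    (hx : x ∈ N.baseChange A) : ν.rTensor M x ∈ N.baseChange B := by
  obtain ⟨x, rfl⟩ := Submodule.toBaseChange_surjective' A N hx
  clear hx
  induction x with
  | zero => simp
  | add x y hx hy =>
    rw [map_add, Submodule.coe_add, map_add]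
    exact add_mem hx hy
  | tmul a n => exact Submodule.tmul_mem_baseChange_of_mem _ n.2

end Slice

theorem mem_range_algebraMap_of_tmul_one_eq {R S : Type*} [CommRing R] [CommRing S] [Algebra R S]
    [Module.FaithfullyFlat R S] {c : S} (h : c ⊗ₜ[R] (1 : S) = 1 ⊗ₜ[R] c) :
    c ∈ Set.range (algebraMap R S) :=
  (Algebra.IsEffective.of_faithfullyFlat R S c).1 (by simp [h])

namespace DInf

open localNori

variable {k K P : Type u} [Field k] [Field K] [Field P] [Algebra K P] [Algebra k P]

/-- The largest subspace `V'` of `V` such that `ψ` maps `P ⊗ V'` into `P ⊗ U`. -/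
def descend (X : DInf k K P) (U : Submodule k X.W) : Submodule K X.V :=
  (((U.baseChange P).comap X.ψ.toLinearMap).restrictScalars K).comap (TensorProduct.mk K P X.V 1)

theorem mem_descend {X : DInf k K P} {U : Submodule k X.W} {v : X.V} :
    v ∈ X.descend U ↔ X.ψ (1 ⊗ₜ v) ∈ U.baseChange P :=
  Iff.rfl

theorem map_ψ_baseChange_descend_le (X : DInf k K P) (U : Submodule k X.W) :
    ((X.descend U).baseChange P).map X.ψ.toLinearMap ≤ U.baseChange P := by
  rw [Submodule.map_le_iff_le_comap, Submodule.baseChange_eq_span, Submodule.span_le]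
  rintro _ ⟨v, hv, rfl⟩
  exact hv

variable [Algebra k K] [IsScalarTower k K P]

variable (k K P) in
/-- The canonical point of `π^L(K/k)` with values in `P ⊗_K P`, which compares the two base changes
of `ψ` to `P ⊗_K P`. -/
def canonicalPoint : localNori k K P (P ⊗[K] P) :=
  ofPair Algebra.TensorProduct.includeLeft Algebra.TensorProduct.includeRight

theorem rTensor_baseChange_smul {W : Type*} [AddCommGroup W] [Module k W] (μ : Module.Dual K P)
    (p : P) (z : P ⊗[k] W) :
    ((Module.Dual.baseChange P μ).restrictScalars k).rTensor W (((1 : P) ⊗ₜ[K] p) •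
      ((Algebra.TensorProduct.includeLeft : P →ₐ[K] P ⊗[K] P).restrictScalars
        k).toLinearMap.rTensor W z) = (μ p • (1 : P)) • z := by
  induction z with
  | zero => simp
  | add x y hx hy => simp only [map_add, smul_add, hx, hy]
  | tmul q w => simp [TensorProduct.smul_tmul']

theorem rTensor_baseChange_pullback (X : DInf k K P) (μ : Module.Dual K P) (y : P ⊗[K] X.V) :
    ((Module.Dual.baseChange P μ).restrictScalars k).rTensor X.W
      (pullback Algebra.TensorProduct.includeLeft X
        ((Algebra.TensorProduct.includeRight : P →ₐ[K] P ⊗[K] P).toLinearMap.rTensor X.V y)) =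
      X.ψ (1 ⊗ₜ[K] slice μ y) := by
  induction y with
  | zero => simp
  | add x y hx hy => simp only [map_add, TensorProduct.tmul_add, hx, hy]
  | tmul p v =>
    have tmul_eq :
        (Algebra.TensorProduct.includeRight : P →ₐ[K] P ⊗[K] P).toLinearMap.rTensor X.V (p ⊗ₜ v) =
          ((1 : P) ⊗ₜ[K] p) • (Algebra.TensorProduct.includeLeft :
            P →ₐ[K] P ⊗[K] P).toLinearMap.rTensor X.V (1 ⊗ₜ v) := by
      simp [TensorProduct.smul_tmul']
    rw [tmul_eq, map_smul, pullback_rTensor, rTensor_baseChange_smul, slice_tmul, ψ_smul]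

theorem rTensor_baseChange_canonicalPoint (X : DInf k K P) (μ : Module.Dual K P) (w : X.W) :
    ((Module.Dual.baseChange P μ).restrictScalars k).rTensor X.W
      ((canonicalPoint k K P).1 X (1 ⊗ₜ w)) = X.ψ (1 ⊗ₜ[K] slice μ (X.ψ.symm (1 ⊗ₜ w))) := by
  have h := ofPair_pullback Algebra.TensorProduct.includeLeft
    (Algebra.TensorProduct.includeRight : P →ₐ[K] P ⊗[K] P) X
    ((Algebra.TensorProduct.includeRight : P →ₐ[K] P ⊗[K] P).toLinearMap.rTensor X.V
      (X.ψ.symm (1 ⊗ₜ w)))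
  rw [pullback_rTensor, LinearEquiv.apply_symm_apply] at h
  rw [← rTensor_baseChange_pullback, ← h, LinearMap.rTensor_tmul, AlgHom.toLinearMap_apply,
    map_one]
  rfl

theorem slice_mem_descend {X : DInf k K P} {U : Submodule k X.W} {w : X.W}
    (hw : (canonicalPoint k K P).1 X (1 ⊗ₜ w) ∈ U.baseChange (P ⊗[K] P)) (μ : Module.Dual K P) :
    slice μ (X.ψ.symm (1 ⊗ₜ w)) ∈ X.descend U := by
  rw [mem_descend, ← rTensor_baseChange_canonicalPoint]
  exact rTensor_mem_baseChange _ hw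

theorem map_ψ_baseChange_descend {X : DInf k K P} {U : Submodule k X.W}
    (hU : ∀ w ∈ U, (canonicalPoint k K P).1 X (1 ⊗ₜ w) ∈ U.baseChange (P ⊗[K] P)) :
    ((X.descend U).baseChange P).map X.ψ.toLinearMap = U.baseChange P := by
  refine le_antisymm (map_ψ_baseChange_descend_le X U) ?_
  rw [Submodule.baseChange_eq_span P U, Submodule.span_le]
  rintro _ ⟨w, hw, rfl⟩
  exact ⟨X.ψ.symm (1 ⊗ₜ w), mem_baseChange_of_slice_mem (slice_mem_descend (hU w hw)),
    X.ψ.apply_symm_apply _⟩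

theorem exists_hom_range_eq {X : DInf k K P} {U : Submodule k X.W}
    (hU : ∀ w ∈ U, (canonicalPoint k K P).1 X (1 ⊗ₜ w) ∈ U.baseChange (P ⊗[K] P)) :
    ∃ (Y : DInf k K P) (f : Y ⟶ X), f.b.range = U := by
  let toV := Submodule.toBaseChange.toLinearEquiv P (X.descend U)
  let toW := Submodule.toBaseChange.toLinearEquiv P U
  let ψU : P ⊗[K] X.descend U ≃ₗ[P] P ⊗[k] U :=
    toV ≪≫ₗ X.ψ.ofSubmodules _ _ (map_ψ_baseChange_descend hU) ≪≫ₗ toW.symm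
  have ψU_comm (x) : (toW (ψU x) : P ⊗[k] X.W) = X.ψ (toV x) := by simp [ψU]
  exact ⟨{ V := X.descend U, W := U, ψ := ψU }, ⟨(X.descend U).subtype, U.subtype,
    LinearMap.ext fun x => (ψU_comm x).symm⟩, U.range_subtype⟩

end DInf

/-! ### Characters -/

theorem dual_baseChange_tmul_one {R S M : Type*} [CommRing R] [CommRing S] [Algebra R S]
    [AddCommGroup M] [Module R M] (ξ : Module.Dual R M) (x : S ⊗[R] M) :
    Module.Dual.baseChange S ξ x ⊗ₜ[R] (1 : R) = LinearMap.baseChange S ξ x :=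
  (AlgebraTensorModule.rid R S S).symm_apply_apply _

section Proportional

variable {K P V : Type*} [Field K] [Field P] [Algebra K P] [AddCommGroup V] [Module K V]

theorem div_mem_range_algebraMap {x y : P} {u : P ⊗[K] P} (hy₀ : y ≠ 0)
    (hx : x ⊗ₜ[K] (1 : P) = u * (1 ⊗ₜ[K] x)) (hy : y ⊗ₜ[K] (1 : P) = u * (1 ⊗ₜ[K] y)) :
    x / y ∈ Set.range (algebraMap K P) := by
  have u_eq : u = y ⊗ₜ[K] y⁻¹ :=
    calc u = u * (1 ⊗ₜ[K] y) * (1 ⊗ₜ[K] y⁻¹) := by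
          rw [mul_assoc, Algebra.TensorProduct.tmul_mul_tmul, one_mul, mul_inv_cancel₀ hy₀,
            ← Algebra.TensorProduct.one_def, mul_one]
      _ = y ⊗ₜ[K] y⁻¹ := by rw [← hy, Algebra.TensorProduct.tmul_mul_tmul, mul_one, one_mul]
  apply mem_range_algebraMap_of_tmul_one_eq
  calc (x / y) ⊗ₜ[K] (1 : P) = (y⁻¹ ⊗ₜ[K] 1) * (x ⊗ₜ[K] 1) := by simp [div_eq_inv_mul]
    _ = (y⁻¹ ⊗ₜ[K] 1) * (y ⊗ₜ[K] y⁻¹ * (1 ⊗ₜ[K] x)) := by rw [hx, u_eq]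
    _ = 1 ⊗ₜ[K] (x / y) := by simp [hy₀, div_eq_inv_mul]

theorem exists_eq_mul_algebraMap {l : V →ₗ[K] P} {u : P ⊗[K] P}
    (h : ∀ v, l v ⊗ₜ[K] (1 : P) = u * (1 ⊗ₜ[K] l v)) (hl : l ≠ 0) :
    ∃ (φ : Pˣ) (a : V →ₗ[K] K), ∀ v, l v = φ * algebraMap K P (a v) := by
  obtain ⟨v₀, hv₀⟩ := DFunLike.ne_iff.mp hl
  obtain ⟨r, hr⟩ := (Algebra.linearMap K P).exists_leftInverse_of_injective
    (LinearMap.ker_eq_bot.mpr (algebraMap K P).injective)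
  refine ⟨Units.mk0 (l v₀) hv₀, r ∘ₗ LinearMap.mulLeft K (l v₀)⁻¹ ∘ₗ l, fun v => ?_⟩
  obtain ⟨c, hc⟩ := div_mem_range_algebraMap hv₀ (h v) (h v₀)
  have r_apply : r ((l v₀)⁻¹ * l v) = c := by
    rw [← div_eq_inv_mul, ← hc]
    exact LinearMap.congr_fun hr c
  rw [LinearMap.comp_apply, LinearMap.comp_apply, LinearMap.mulLeft_apply, r_apply, hc,
    Units.val_mk0, mul_div_cancel₀ _ hv₀]

end Proportional

namespace localNori

open DInf

variable {k K P : Type u} [Field k] [Field K] [Field P] [Algebra K P] [Algebra k P]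
  {R S : Type u} [CommRing R] [Algebra k R] [CommRing S] [Algebra k S]

/-- The scalar by which a point of `π^L(K/k)` acts on the line `ω(K, k, φ) = k`. -/
def lineScalar (φ : Pˣ) (g : localNori k K P R) : R :=
  coeff g (line k K φ) LinearMap.id (1 : k)

theorem apply_line (g : localNori k K P R) (φ : Pˣ) (x : R ⊗[k] (line k K φ).W) :
    g.1 (line k K φ) x = lineScalar φ g • x := by
  have apply_one : g.1 (line k K φ) (1 ⊗ₜ (1 : k)) = lineScalar φ g ⊗ₜ (1 : k) := by
    rw [lineScalar, coeff_apply]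
    exact ((dual_baseChange_tmul_one (LinearMap.id : k →ₗ[k] k) _).trans
      (LinearMap.congr_fun (LinearMap.baseChange_id ..) _)).symm
  refine LinearMap.congr_fun (f := (g.1 (line k K φ)).toLinearMap)
    (g := lineScalar φ g • LinearMap.id) ?_ x
  ext
  simpa [TensorProduct.smul_tmul'] using apply_one

theorem lineScalar_mul (φ : Pˣ) (g h : localNori k K P R) :
    lineScalar φ (g * h) = lineScalar φ g * lineScalar φ h := by
  change Module.Dual.baseChange R _ (g.1 (line k K φ) (h.1 (line k K φ) _)) = _
  rw [apply_line, map_smul]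
  rfl

theorem lineScalar_one (φ : Pˣ) : lineScalar φ (1 : localNori k K P R) = 1 := by
  change Module.Dual.baseChange R (LinearMap.id : k →ₗ[k] k) (1 ⊗ₜ 1) = 1
  simp

/-- The character through which `π^L(K/k)` acts on the line `ω(K, k, φ)`. -/
def lineCharacter (φ : Pˣ) : characters k K P :=
  ⟨fun _ => MonoidHom.toHomUnits ⟨⟨lineScalar φ, lineScalar_one φ⟩, lineScalar_mul φ⟩,
    fun _ _ f g => coeff_map f g _ _ _⟩

theorem characters_ext {χ χ' : characters k K P}
    (h : ∀ (R : CommAlgCat.{u} k) (g : localNori k K P R), (χ.1 R g : R) = χ'.1 R g) : χ = χ' :=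
  Subtype.ext <| funext fun R => MonoidHom.ext fun g => Units.ext (h R g)

theorem apply_of_iso_line {X : DInf k K P} {φ : Pˣ} (e : X ≅ line k K φ) (R : CommAlgCat.{u} k)
    (g : localNori k K P R) (x : R ⊗[k] X.W) :
    g.1 X x = ((lineCharacter φ).1 R g : R) • x := by
  have inv_hom (y : R ⊗[k] X.W) :
      (Hom.b e.inv).baseChange R ((Hom.b e.hom).baseChange R y) = y := by
    rw [← LinearMap.comp_apply, ← LinearMap.baseChange_comp, ← comp_b, e.hom_inv_id, id_b,
      LinearMap.baseChange_id, LinearMap.id_apply]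
  rw [← inv_hom (g.1 X x), ← apply_hom, apply_line, map_smul, inv_hom]
  rfl

theorem eq_lineCharacter_of_iso {χ : characters k K P} {X : DInf k K P} {φ : Pˣ}
    (e : X ≅ line k K φ) {ξ : Module.Dual k X.W} {w : X.W} (hξ : ξ w = 1)
    (hχ : ∀ (R : CommAlgCat.{u} k) (g : localNori k K P R), coeff g X ξ w = χ.1 R g) :
    χ = lineCharacter φ :=
  characters_ext fun R g => by
    rw [← hχ, coeff_apply, apply_of_iso_line e, map_smul, Module.Dual.baseChange_apply_tmul, hξ,
      one_smul, smul_eq_mul, mul_one]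

theorem lineCharacter_eq_of_iso {φ φ' : Pˣ} (e : line k K φ ≅ line k K φ') :
    (lineCharacter φ : characters k K P) = lineCharacter φ' :=
  eq_lineCharacter_of_iso e (w := (1 : k)) rfl fun _ _ => rfl

/-- The isomorphism `(K, k, φ) ⊗ (K, k, φ') ≅ (K, k, φ φ')` given by multiplication. -/
def lineTensorIso (φ φ' : Pˣ) : line k K φ ⊗ line k K φ' ≅ line k K (φ * φ') :=
  mkIso (TensorProduct.lid K K) (TensorProduct.lid k k) <| baseChange_tensor_ext fun c c' => by
    change (line k K (φ * φ')).ψ (1 ⊗ₜ[K] (c • c')) =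
      (TensorProduct.lid k k).toLinearMap.baseChange P
        (tensorψ (line k K φ) (line k K φ') (1 ⊗ₜ[K] (c ⊗ₜ[K] c')))
    rw [tensorψ_tmul, line_ψ_tmul, line_ψ_tmul, line_ψ_tmul]
    refine Eq.trans ?_ (lid_baseChange_distrib _ _).symm
    rw [TensorProduct.smul_tmul']
    congr 1
    simp only [smul_eq_mul, Algebra.smul_def, map_mul, Units.val_mul]
    ring

theorem lineCharacter_mul (φ φ' : Pˣ) :
    (lineCharacter (φ * φ') : characters k K P) = lineCharacter φ * lineCharacter φ' :=
  (eq_lineCharacter_of_iso (lineTensorIso φ φ')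
    (ξ := LinearMap.mul' k k ∘ₗ TensorProduct.map .id .id) (w := (1 : k) ⊗ₜ[k] (1 : k))
    (mul_one (1 : k)) fun _ g => coeff_tensor g _ _ _ _ _ _).symm

/-- The character of the line `(K, k, φ)`, as a homomorphism in `φ`. -/
def lineCharacterHom (k K P : Type u) [Field k] [Field K] [Field P] [Algebra K P] [Algebra k P] :
    Pˣ →* characters k K P :=
  MonoidHom.mk' lineCharacter lineCharacter_mul

theorem slice_coeff_mul (γ : localNori k K P S) (g : localNori k K P R) (μ : Module.Dual k S)
    (X : DInf k K P) (ξ : Module.Dual k X.W) (w : X.W) :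
    slice μ (coeff (map (Algebra.TensorProduct.includeRight : R →ₐ[k] S ⊗[k] R) g *
      map Algebra.TensorProduct.includeLeft γ) X ξ w) =
      coeff g X ξ (slice μ (γ.1 X (1 ⊗ₜ w))) := by
  let i₁ : S →ₐ[k] S ⊗[k] R := Algebra.TensorProduct.includeLeft
  let i₂ : R →ₐ[k] S ⊗[k] R := Algebra.TensorProduct.includeRight
  have slice_apply (x : S ⊗[k] X.W) :
      slice μ (Module.Dual.baseChange (S ⊗[k] R) ξ
        ((map i₂ g).1 X (i₁.toLinearMap.rTensor X.W x))) = coeff g X ξ (slice μ x) := by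
    induction x with
    | zero => simp
    | add x y hx hy => simp only [map_add, hx, hy]
    | tmul s w =>
      have rTensor_tmul : i₁.toLinearMap.rTensor X.W (s ⊗ₜ w) = i₁ s • (1 ⊗ₜ[k] w) := by
        simp [TensorProduct.smul_tmul']
      rw [rTensor_tmul, map_smul, map_smul, ← coeff_apply, coeff_map]
      simp [i₁, i₂]
  rw [← slice_apply, ← map_apply_rTensor, LinearMap.rTensor_tmul, AlgHom.toLinearMap_apply,
    map_one]
  rfl

theorem character_mul_includeRight_includeLeft (χ : characters k K P) {R S : CommAlgCat.{u} k}
    (γ : localNori k K P S) (g : localNori k K P R) :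
    ((χ.1 (CommAlgCat.of k (S ⊗[k] R)) (map Algebra.TensorProduct.includeRight g *
      map Algebra.TensorProduct.includeLeft γ) : (S ⊗[k] R)ˣ) : S ⊗[k] R) =
      (χ.1 S γ : S) ⊗ₜ[k] (χ.1 R g : R) := by
  have natural_left := χ.2 S (CommAlgCat.of k (S ⊗[k] R)) Algebra.TensorProduct.includeLeft γ
  have natural_right := χ.2 R (CommAlgCat.of k (S ⊗[k] R)) Algebra.TensorProduct.includeRight g
  rw [map_mul, Units.val_mul]
  refine (congrArg₂ (· * ·) natural_right natural_left).trans ?_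
  exact (Algebra.TensorProduct.tmul_mul_tmul ..).trans (by rw [one_mul, mul_one])

/-- The vectors `w` of `ω(X)` whose matrix coefficient with `ξ` is `ξ(w)` times the character
`χ`. -/
def eigenspace (χ : characters k K P) (X : DInf k K P) (ξ : Module.Dual k X.W) :
    Submodule k X.W where
  carrier := {w | ∀ (R : CommAlgCat.{u} k) (g : localNori k K P R),
    coeff g X ξ w = ξ w • (χ.1 R g : R)}
  add_mem' hv hw R g := by rw [map_add, hv, hw, map_add, add_smul]
  zero_mem' R g := by simp
  smul_mem' c w hw R g := by rw [map_smul, hw, map_smul, smul_assoc]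

/-- Evaluate the eigenvalue equation at the product of `g` and `γ` over `S ⊗ R` and slice. -/
theorem slice_mem_eigenspace {χ : characters k K P} {X : DInf k K P} {ξ : Module.Dual k X.W}
    {S : CommAlgCat.{u} k} (γ : localNori k K P S) (μ : Module.Dual k S) {w : X.W}
    (hw : w ∈ eigenspace χ X ξ) : slice μ (γ.1 X (1 ⊗ₜ w)) ∈ eigenspace χ X ξ := by
  intro R g
  have coeff_mul := hw (CommAlgCat.of k (S ⊗[k] R))
    (map Algebra.TensorProduct.includeRight g * map Algebra.TensorProduct.includeLeft γ)
  rw [character_mul_includeRight_includeLeft] at coeff_mul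
  rw [← slice_coeff_mul, dual_slice, ← coeff_apply, hw S γ]
  refine (congrArg (slice μ) coeff_mul).trans ?_
  rw [TensorProduct.smul_tmul', slice_tmul]

theorem dual_baseChange_apply {g : localNori k K P R} {X : DInf k K P} {ξ : Module.Dual k X.W}
    {u : R} (h : ∀ w, coeff g X ξ w = ξ w • u) (x : R ⊗[k] X.W) :
    Module.Dual.baseChange R ξ (g.1 X x) = u * Module.Dual.baseChange R ξ x := by
  refine LinearMap.congr_fun (f := Module.Dual.baseChange R ξ ∘ₗ (g.1 X).toLinearMap)
    (g := u • Module.Dual.baseChange R ξ) ?_ x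
  ext w
  simpa [mul_comm, coeff_apply] using h w

end localNori

namespace DInf

open localNori

variable {k K P : Type u} [Field k] [Field K] [Field P] [Algebra K P] [Algebra k P]

/-- The periods of `X` along `ξ`: the `K`-linear map `v ↦ ξ(ψ(1 ⊗ v))`, where `ξ` is extended to a
`P`-linear form. -/
def period (X : DInf k K P) (ξ : Module.Dual k X.W) : X.V →ₗ[K] P :=
  (Module.Dual.baseChange P ξ).restrictScalars K ∘ₗ
    X.ψ.toLinearMap.restrictScalars K ∘ₗ TensorProduct.mk K P X.V 1

theorem eq_zero_of_period_eq_zero {X : DInf k K P} {ξ : Module.Dual k X.W}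
    (h : X.period ξ = 0) : ξ = 0 := by
  have comp_eq_zero : Module.Dual.baseChange P ξ ∘ₗ X.ψ.toLinearMap = 0 := by
    ext v
    exact LinearMap.congr_fun h v
  ext w
  have apply_eq_zero := LinearMap.congr_fun comp_eq_zero (X.ψ.symm (1 ⊗ₜ w))
  simpa using apply_eq_zero

variable [Algebra k K] [IsScalarTower k K P]

theorem period_tmul_one {X : DInf k K P} {ξ : Module.Dual k X.W} {u : P ⊗[K] P}
    (h : ∀ w, coeff (canonicalPoint k K P) X ξ w = ξ w • u) (v : X.V) :
    X.period ξ v ⊗ₜ[K] (1 : P) = u * (1 ⊗ₜ[K] X.period ξ v) := by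
  have dual_pullback (f : P →ₐ[K] P ⊗[K] P) :
      Module.Dual.baseChange (P ⊗[K] P) ξ (pullback f X (1 ⊗ₜ v)) = f (X.period ξ v) := by
    have pullback_one_tmul := pullback_rTensor f X (1 ⊗ₜ v)
    rw [LinearMap.rTensor_tmul, AlgHom.toLinearMap_apply, map_one] at pullback_one_tmul
    rw [pullback_one_tmul, dual_baseChange_rTensor]
    rfl
  have key := dual_baseChange_apply h (pullback Algebra.TensorProduct.includeRight X (1 ⊗ₜ v))
  rwa [canonicalPoint, ofPair_pullback, dual_pullback, dual_pullback] at key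

theorem exists_hom_line {X : DInf k K P} {ξ : Module.Dual k X.W} {u : P ⊗[K] P}
    (h : ∀ w, coeff (canonicalPoint k K P) X ξ w = ξ w • u) (hξ : ξ ≠ 0) :
    ∃ (φ : Pˣ) (f : X ⟶ line k K φ), f.b = ξ := by
  obtain ⟨φ, a, ha⟩ :=
    exists_eq_mul_algebraMap (period_tmul_one h) (mt eq_zero_of_period_eq_zero hξ)
  refine ⟨φ, ⟨a, ξ, ?_⟩, rfl⟩
  ext v
  calc (line k K φ).ψ (1 ⊗ₜ[K] a v) = X.period ξ v ⊗ₜ[k] (1 : k) := by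
        rw [line_ψ_tmul, ha, Algebra.algebraMap_eq_smul_one]
    _ = LinearMap.baseChange P ξ (X.ψ (1 ⊗ₜ v)) := dual_baseChange_tmul_one ξ _

end DInf

namespace localNori

open DInf

variable {k K P : Type u} [Field k] [Field K] [Field P] [Algebra K P] [Algebra k P]
  [Algebra k K] [IsScalarTower k K P]

theorem exists_eq_lineCharacter {χ : characters k K P} {X : DInf k K P} {ξ : Module.Dual k X.W}
    (h : ∀ (R : CommAlgCat.{u} k) (g : localNori k K P R) (w : X.W),
      coeff g X ξ w = ξ w • (χ.1 R g : R)) (hξ : ξ ≠ 0) :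
    ∃ φ : Pˣ, lineCharacter φ = χ := by
  obtain ⟨φ, f, hf⟩ :=
    exists_hom_line (h (CommAlgCat.of k (P ⊗[K] P)) (canonicalPoint k K P)) hξ
  obtain ⟨w, hw⟩ : ∃ w, ξ w = 1 := LinearMap.surjective hξ 1
  refine ⟨φ, characters_ext fun R g => ?_⟩
  have coeff_line := coeff_hom g f LinearMap.id w
  rw [hf, hw, LinearMap.id_comp, h, hw, one_smul] at coeff_line
  exact coeff_line

theorem lineCharacter_surjective :
    Function.Surjective (lineCharacter : Pˣ → characters k K P) := by
  intro χ
  obtain ⟨X, ξ, w, hχ⟩ := exists_coeff_eq_character χ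
  have ξ_w : ξ w = 1 := by
    have coeff_one := hχ (CommAlgCat.of k k) 1
    rw [map_one, Units.val_one] at coeff_one
    change 1 = Module.Dual.baseChange k ξ (1 ⊗ₜ w) at coeff_one
    simpa using coeff_one.symm
  have w_mem : w ∈ eigenspace χ X ξ := fun R g => by rw [← hχ, ξ_w, one_smul]
  obtain ⟨Y, f, hf⟩ := exists_hom_range_eq (U := eigenspace χ X ξ) fun v hv =>
    mem_baseChange_of_slice_mem fun μ =>
      slice_mem_eigenspace (S := CommAlgCat.of k (P ⊗[K] P)) (canonicalPoint k K P) μ hv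
  refine exists_eq_lineCharacter (X := Y) (ξ := ξ ∘ₗ f.b) (fun R g y => ?_) fun h => ?_
  · have y_mem : f.b y ∈ eigenspace χ X ξ := hf ▸ LinearMap.mem_range_self f.b y
    rw [← coeff_hom]
    exact y_mem R g
  · obtain ⟨y, rfl⟩ : w ∈ f.b.range := hf ▸ w_mem
    simp [← LinearMap.comp_apply, h] at ξ_w

theorem mem_range_of_lineCharacter_eq_one {φ : Pˣ}
    (h : (lineCharacter φ : characters k K P) = 1) : (φ : P) ∈ Set.range (algebraMap K P) := by
  have scalar_eq_one : lineScalar φ (canonicalPoint k K P) = 1 :=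
    congrArg (fun χ : characters k K P =>
      (χ.1 (CommAlgCat.of k (P ⊗[K] P)) (canonicalPoint k K P) : P ⊗[K] P)) h
  have compare := ofPair_pullback Algebra.TensorProduct.includeLeft
    (Algebra.TensorProduct.includeRight : P →ₐ[K] P ⊗[K] P) (line k K φ) (1 ⊗ₜ[K] (1 : K))
  rw [← canonicalPoint, apply_line, scalar_eq_one, one_smul, pullback_line, pullback_line]
    at compare
  exact mem_range_algebraMap_of_tmul_one_eq
    ((AlgebraTensorModule.rid k (P ⊗[K] P) (P ⊗[K] P)).symm.injective compare).symm

end localNori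

/-! ### The Picard group -/

theorem finrank_eq_one_of_tensorProduct_equiv {F M N : Type*} [Field F] [AddCommGroup M]
    [Module F M] [AddCommGroup N] [Module F N] (e : M ⊗[F] N ≃ₗ[F] F) :
    Module.finrank F M = 1 := by
  have finrank_mul := e.finrank_eq
  rw [Module.finrank_tensorProduct, Module.finrank_self] at finrank_mul
  exact Nat.eq_one_of_mul_eq_one_right finrank_mul

namespace DInf

open localNori

variable {k K P : Type u} [Field k] [Field K] [Field P] [Algebra K P] [Algebra k P]

theorem exists_iso_line (X : DInf k K P) (a : X.V ≃ₗ[K] K) (b : X.W ≃ₗ[k] k) :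
    ∃ φ : Pˣ, Nonempty (X ≅ line k K φ) := by
  have period_eq (v : X.V) : X.period b v = a v • X.period b (a.symm 1) := by
    rw [← map_smul, ← map_smul, smul_eq_mul, mul_one, LinearEquiv.symm_apply_apply]
  have period_ne_zero : X.period b (a.symm 1) ≠ 0 := fun h => by
    have b_eq_zero : (b : X.W →ₗ[k] k) = 0 :=
      eq_zero_of_period_eq_zero (LinearMap.ext fun v => by simp [period_eq v, h])
    simpa using LinearMap.congr_fun b_eq_zero (b.symm 1)
  refine ⟨Units.mk0 _ period_ne_zero, ⟨mkIso a b ?_⟩⟩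
  ext v
  calc (line k K (Units.mk0 _ period_ne_zero)).ψ (1 ⊗ₜ[K] a v)
      = X.period b v ⊗ₜ[k] (1 : k) := by
        rw [line_ψ_tmul, Units.val_mk0, mul_smul_one, ← period_eq]
    _ = b.toLinearMap.baseChange P (X.ψ (1 ⊗ₜ v)) := dual_baseChange_tmul_one _ _

/-- The `K`-linear isomorphism underlying an isomorphism of `D_∞(K/k)`. -/
def isoV {X Y : DInf k K P} (e : X ≅ Y) : X.V ≃ₗ[K] Y.V :=
  .ofLinearMap (Hom.a e.hom) (Hom.a e.inv)
    (by rw [← comp_a, e.inv_hom_id, id_a]) (by rw [← comp_a, e.hom_inv_id, id_a])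

/-- The `k`-linear isomorphism underlying an isomorphism of `D_∞(K/k)`. -/
def isoW {X Y : DInf k K P} (e : X ≅ Y) : X.W ≃ₗ[k] Y.W :=
  .ofLinearMap (Hom.b e.hom) (Hom.b e.inv)
    (by rw [← comp_b, e.inv_hom_id, id_b]) (by rw [← comp_b, e.hom_inv_id, id_b])

theorem exists_iso_line_of_tensor_iso {X Y : DInf k K P} (e : X ⊗ Y ≅ 𝟙_ (DInf k K P)) :
    ∃ φ : Pˣ, Nonempty (X ≅ line k K φ) := by
  have finrank_V : Module.finrank K X.V = 1 :=
    finrank_eq_one_of_tensorProduct_equiv (N := Y.V) (isoV e)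
  have finrank_W : Module.finrank k X.W = 1 :=
    finrank_eq_one_of_tensorProduct_equiv (N := Y.W) (isoW e)
  exact exists_iso_line X
    (.ofFinrankEq X.V K (by rw [finrank_V, Module.finrank_self]))
    (.ofFinrankEq X.W k (by rw [finrank_W, Module.finrank_self]))

variable (k K P) in
/-- The homomorphism `P^* → Pic(D_∞(K/k))` that sends `φ` to the class of `(K, k, φ)`. -/
def linePic : Pˣ →* Pic k K P :=
  MonoidHom.toHomUnits
    { toFun := fun φ => toSkeleton (line k K φ)
      map_one' := rfl
      map_mul' := fun φ φ' => by
        rw [← Skeleton.toSkeleton_tensorObj, toSkeleton_eq_toSkeleton_iff]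
        exact ⟨(lineTensorIso φ φ').symm⟩ }

theorem linePic_surjective : Function.Surjective (linePic k K P) := by
  intro L
  have mul_inv : (L : Skeleton (DInf k K P)) * (L⁻¹ : Pic k K P) = 1 := L.mul_inv
  rw [Skeleton.mul_eq, Skeleton.one_eq, toSkeleton_eq_toSkeleton_iff] at mul_inv
  obtain ⟨e⟩ := mul_inv
  obtain ⟨φ, ⟨i⟩⟩ := exists_iso_line_of_tensor_iso e
  exact ⟨φ, Units.ext ((congr_toSkeleton_of_iso i.symm).trans (Quotient.out_eq _))⟩

theorem linePic_algebraMap (c : Kˣ) :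
    linePic k K P (Units.map (algebraMap K P : K →* P) c) = 1 := by
  refine Units.ext (congr_toSkeleton_of_iso (Y := line k K 1)
    (mkIso (LinearEquiv.smulOfUnit c : K ≃ₗ[K] K) (.refl k k) ?_))
  ext
  change (line k K (1 : Pˣ)).ψ (1 ⊗ₜ[K] (c • (1 : K))) =
    LinearMap.baseChange P (LinearEquiv.refl k k).toLinearMap
      ((line k K (Units.map (algebraMap K P : K →* P) c)).ψ (1 ⊗ₜ[K] (1 : K)))
  rw [line_ψ_tmul, line_ψ_tmul]
  simp [Units.smul_def, Algebra.smul_def]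

theorem ker_linePic_le_ker_lineCharacterHom :
    (linePic k K P).ker ≤ (lineCharacterHom k K P).ker := by
  intro φ hφ
  have class_eq : toSkeleton (line k K φ) = toSkeleton (line k K (1 : Pˣ)) :=
    congrArg Units.val hφ
  obtain ⟨e⟩ := toSkeleton_eq_toSkeleton_iff.mp class_eq
  exact (lineCharacter_eq_of_iso e).trans (lineCharacterHom k K P).map_one

theorem range_le_ker_linePic :
    (Units.map (algebraMap K P : K →* P)).range ≤ (linePic k K P).ker := by
  rintro _ ⟨c, rfl⟩
  exact linePic_algebraMap c

variable [Algebra k K] [IsScalarTower k K P]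

theorem ker_lineCharacterHom_le_range :
    (lineCharacterHom k K P).ker ≤ (Units.map (algebraMap K P : K →* P)).range := by
  intro φ hφ
  obtain ⟨c, hc⟩ := mem_range_of_lineCharacter_eq_one hφ
  have c_ne_zero : c ≠ 0 := by
    rintro rfl
    exact φ.ne_zero (hc.symm.trans (map_zero _))
  exact ⟨Units.mk0 c c_ne_zero, Units.ext hc⟩

theorem ker_linePic :
    (linePic k K P).ker = (Units.map (algebraMap K P : K →* P)).range :=
  le_antisymm (ker_linePic_le_ker_lineCharacterHom.trans ker_lineCharacterHom_le_range)
    range_le_ker_linePic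

theorem ker_lineCharacterHom :
    (lineCharacterHom k K P).ker = (Units.map (algebraMap K P : K →* P)).range :=
  le_antisymm ker_lineCharacterHom_le_range
    (range_le_ker_linePic.trans ker_linePic_le_ker_lineCharacterHom)

variable (k K P) in
/-- The isomorphism `P^* / K^* ≃ Pic(D_∞(K/k))` induced by `φ ↦ (K, k, φ)`. -/
def quotientEquivPic :
    Pˣ ⧸ (Units.map (algebraMap K P : K →* P)).range ≃* Pic k K P :=
  (QuotientGroup.quotientMulEquivOfEq ker_linePic.symm).trans
    (QuotientGroup.quotientKerEquivOfSurjective _ linePic_surjective)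

variable (k K P) in
/-- The isomorphism `P^* / K^* ≃ Hom(π^L(K/k), 𝔾_m)` induced by `φ ↦ (K, k, φ)`. -/
def quotientEquivCharacters :
    Pˣ ⧸ (Units.map (algebraMap K P : K →* P)).range ≃* characters k K P :=
  (QuotientGroup.quotientMulEquivOfEq ker_lineCharacterHom.symm).trans
    (QuotientGroup.quotientKerEquivOfSurjective (lineCharacterHom k K P) lineCharacter_surjective)

end DInf

end

theorem mainTheorem2_general {k K P : Type u} [Field k] [Field K] [Algebra k K] [Field P]
    [Algebra K P] [Algebra k P] [IsScalarTower k K P] :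
    localNori.IsAffineGroupScheme k K P ∧
    ∃ (α : DInf.Pic k K P ≃* localNori.characters k K P)
      (β : localNori.characters k K P ≃* Pˣ ⧸ (Units.map (algebraMap K P : K →* P)).range),
      (∀ (L : DInf.Pic k K P) (X : DInf k K P), toSkeleton X = (L : Skeleton (DInf k K P)) →
        ∀ (R : CommAlgCat.{u} k) (g : localNori k K P R) (x : R ⊗[k] X.W),
          g.1 X x = ((α L).1 R g : R) • x) ∧
      ∀ φ : Pˣ, ((α.symm (β.symm (QuotientGroup.mk φ)) : DInf.Pic k K P) :
        Skeleton (DInf k K P)) = toSkeleton (DInf.line k K φ) := by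
  refine ⟨localNori.isAffineGroupScheme k K P,
    (DInf.quotientEquivPic k K P).symm.trans (DInf.quotientEquivCharacters k K P),
    (DInf.quotientEquivCharacters k K P).symm, fun L X hX R g x => ?_, fun φ => ?_⟩
  · obtain ⟨φ, rfl⟩ := DInf.linePic_surjective L
    obtain ⟨e⟩ := toSkeleton_eq_toSkeleton_iff.mp hX
    have symm_linePic :
        (DInf.quotientEquivPic k K P).symm (DInf.linePic k K P φ) = QuotientGroup.mk φ :=
      (MulEquiv.symm_apply_eq _).mpr rfl
    rw [MulEquiv.trans_apply, symm_linePic]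
    exact localNori.apply_of_iso_line e R g x
  · simp only [MulEquiv.symm_trans_apply, MulEquiv.symm_symm, MulEquiv.symm_apply_apply]
    rfl

theorem mainTheorem2 (p : ℕ) [Fact p.Prime] {k K P : Type u} [Field k] [CharP k p] [PerfectField k]
    [Field K] [Algebra k K]
    [Field P] [Algebra K P] [Algebra k P] [IsScalarTower k K P]
    [CharP P p] [PerfectRing P p] [IsPerfectClosure (algebraMap K P) p] :
    localNori.IsAffineGroupScheme k K P ∧
    ∃ (α : DInf.Pic k K P ≃* localNori.characters k K P)
      (β : localNori.characters k K P ≃* Pˣ ⧸ (Units.map (algebraMap K P : K →* P)).range),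
      (∀ (L : DInf.Pic k K P) (X : DInf k K P), toSkeleton X = (L : Skeleton (DInf k K P)) →
        ∀ (R : CommAlgCat.{u} k) (g : localNori k K P R) (x : R ⊗[k] X.W),
          g.1 X x = ((α L).1 R g : R) • x) ∧
      ∀ φ : Pˣ, ((α.symm (β.symm (QuotientGroup.mk φ)) : DInf.Pic k K P) :
        Skeleton (DInf k K P)) = toSkeleton (DInf.line k K φ) :=
  mainTheorem2_general
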